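/- Consider a single additive buyer and $m$ items. Let $V\in\mathbb{R}$ and let $T\subseteq\mathbb{R}_{\ge 0}^m$ be a measurable set of types $t=(t_1,\dots,t_m)$ ($t_i$ is the value of item $i$) such that $\sum_i t_i\le V$ for all $t\in T$. A (direct, randomized) mechanism assigns to every reported type a probability distribution over sets of items and a payment in $[-V,V]$. It is incentive compatible if no type in $T$ can increase her expected utility (expected value of the received items minus payment) by reporting another type in $T$, and individually rational if truthful utility is nonnegative for every type in $T$. For a probability distribution $\mathcal{D}$ supported on $T$, let $Rev(\mathcal{D})$ be the supremum of the expected payment over all measurable incentive compatible and individually rational mechanisms, let $$BRev(\mathcal{D})=\sup_{p\ge 0}\,p\Pr_{t\sim\mathcal{D}}\Big[\sum_i t_i\ge p\Big],\qquad SRev(\mathcal{D})=\sum_{i=1}^m\ \sup_{p\ge 0}\,p\Pr_{t\sim\mathcal{D}}[t_i\ge p]$$ be the optimal revenues of selling the grand bundle and of selling the items separately, and let $d_{\mathsf{TV}}(P,Q)=\sup_E|P(E)-Q(E)|$ over measurable events $E$. A product distribution is one under which the item values $t_1,\dots,t_m$ are independent. (1) For all $m,V,T$ and every distribution $\mathcal{D}$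 supported on $T$ with $Rev(\mathcal{D})\ge 2m\,BRev(\mathcal{D})$, every product distribution $\mathcal{D}^p$ supported on $T$ satisfies $d_{\mathsf{TV}}(\mathcal{D},\mathcal{D}^p)\ge \frac{Rev(\mathcal{D})}{4V}$. (2) There is an absolute constant $C>0$ such that for all $m\ge 2$, all $V,T$ and every distribution $\mathcal{D}$ supported on $T$ with $Rev(\mathcal{D})\ge C\log(m)\,SRev(\mathcal{D})$, every product distribution $\mathcal{D}^p$ supported on $T$ satisfies $d_{\mathsf{TV}}(\mathcal{D},\mathcal{D}^p)\ge \frac{Rev(\mathcal{D})}{4V}$. (When $V=0$ one has $Rev(\mathcal{D})=0$, and $\frac{Rev(\mathcal{D})}{4V}$ is read as $0$.) -/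

import Mathlib

open MeasureTheory

noncomputable section

namespace SimpleVsOptimal

/-- The total variation distance `sup_E |P(E) - Q(E)|`, over all measurable events `E`. -/
def tvDist {Ω : Type*} [MeasurableSpace Ω] (P Q : Measure Ω) : ℝ :=
  ⨆ E : {E : Set Ω // MeasurableSet E}, |P.real E.1 - Q.real E.1|

/-- `T` is a set of types of an additive buyer of `m` items (`t i` is the value of item `i`)
in which all values are nonnegative and no set of items is worth more than `V`. -/
structure IsTypeSpace {m : ℕ} (V : ℝ) (T : Set (Fin m → ℝ)) : Prop where
  measurableSet : MeasurableSet T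
  nonneg : ∀ t ∈ T, ∀ i, 0 ≤ t i
  sum_le : ∀ t ∈ T, ∑ i, t i ≤ V

/-- A probability distribution that is supported on the set `T`. -/
structure IsDistributionOn {m : ℕ} (T : Set (Fin m → ℝ)) (D : Measure (Fin m → ℝ)) : Prop where
  isProbabilityMeasure : IsProbabilityMeasure D
  compl_null : D Tᶜ = 0

/-- A direct mechanism for a single buyer and `m` items: `alloc t` is a probability distribution
on the sets of items, the (random) set of items that the buyer receives after the report `t`,
and `pay t` is her payment. Only the values on the set of types that is considered matter. -/
structure Mechanism (m : ℕ) where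
  alloc : (Fin m → ℝ) → Finset (Fin m) → ℝ
  pay : (Fin m → ℝ) → ℝ
  alloc_mem : ∀ t, alloc t ∈ stdSimplex ℝ (Finset (Fin m))
  measurable_alloc : Measurable alloc
  measurable_pay : Measurable pay

namespace Mechanism

variable {m : ℕ}

/-- The expected utility of an additive buyer of type `t` who reports `s`. -/
def utility (M : Mechanism m) (t s : Fin m → ℝ) : ℝ :=
  (∑ A : Finset (Fin m), M.alloc s A * ∑ i ∈ A, t i) - M.pay s

/-- Payments lie in `[-H, H]` on `T`. -/
def BoundedPayments (M : Mechanism m) (H : ℝ) (T : Set (Fin m → ℝ)) : Prop :=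
  ∀ t ∈ T, M.pay t ∈ Set.Icc (-H) H

/-- Incentive compatibility on `T`: truthful reporting is optimal for every type. -/
def IncentiveCompatible (M : Mechanism m) (T : Set (Fin m → ℝ)) : Prop :=
  ∀ t ∈ T, ∀ s ∈ T, M.utility t s ≤ M.utility t t

/-- Ex-post individual rationality on `T`. -/
def IndividuallyRational (M : Mechanism m) (T : Set (Fin m → ℝ)) : Prop :=
  ∀ t ∈ T, 0 ≤ M.utility t t

/-- The expected revenue of a mechanism with truthful reports. -/
def revenue (M : Mechanism m) (D : Measure (Fin m → ℝ)) : ℝ :=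
  ∫ t, M.pay t ∂D

end Mechanism

variable {m : ℕ}

/-- `Rev(D)`: the optimal (supremal) expected revenue, over the mechanisms on `T` with payments
in `[-V, V]` that are incentive compatible and individually rational. -/
def Rev (V : ℝ) (T : Set (Fin m → ℝ)) (D : Measure (Fin m → ℝ)) : ℝ :=
  sSup {r | ∃ M : Mechanism m, M.BoundedPayments V T ∧ M.IncentiveCompatible T ∧
    M.IndividuallyRational T ∧ r = M.revenue D}

/-- `BRev(D)`: the optimal revenue of selling the grand bundle at a posted price `p`. -/
def BRev (D : Measure (Fin m → ℝ)) : ℝ :=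
  ⨆ p : NNReal, (p : ℝ) * D.real {t | (p : ℝ) ≤ ∑ i, t i}

/-- `SRev(D)`: the optimal revenue of selling each item separately at its own posted price. -/
def SRev (D : Measure (Fin m → ℝ)) : ℝ :=
  ∑ i, ⨆ p : NNReal, (p : ℝ) * D.real {t | (p : ℝ) ≤ t i}

/-- A product distribution with respect to the items: the item values are independent. -/
def IsProductDistribution (D : Measure (Fin m → ℝ)) : Prop :=
  ∃ ν : Fin m → Measure ℝ, (∀ i, IsProbabilityMeasure (ν i)) ∧ D = Measure.pi ν

end SimpleVsOptimal

end

/-!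
Let `s = ∑ i, t i`, and suppose that the total variation distance from `D` to a product distribution
`Dp` on `T` is less than `δ = Rev D / (4 V)`. Every incentive compatible and individually rational
mechanism is shown to earn at most a constant below `Rev D` under `D`, which is absurd.

*Capping.* A payment is at most `s`. The part `max (s - L) 0` is integrated under `D` itself, where
the tails of `s` (or of the single items) are known from the simple revenues. The capped payment
`max (pay - max (s - L) 0) 0` lies in `[0, L]`, so it may be integrated under `Dp` instead at a cost
of `δ * L` (`CloseToProduct.integral_pay_le`).

*One item at a time.* Call the most valuable item of a type its favorite, and let the favorite bear
the whole utility. The capped payment is then a sum of shares of the items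
(`max_pay_sub_le_sum_revenueShare`). Under a product distribution each share can be integrated with
the other values fixed, and in this slice the mechanism is a mixture of posted prices
(`exists_prices_of_slice`). Hence a share costs no more than the best posted price for the item
alone, except that a non-favorite item, which bears no utility, contributes its value instead of
the price when it is sold. Up to a level `b` this is harmless; the rest is the minor excess
(`integral_max_pay_sub_le`).

*The minor excess.* It is the integral over `x ≥ b` of the expected number of non-favorite items of
value at least `x`. If there are `k` of these, then `s ≥ (k + 1) * x`; and under independence their
expected number is of second order in the probability that some item is worth `x`. This gives a
small multiple of `b` (`CloseToProduct.integral_minorExcess_le`).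

*Grand bundle.* With `b = Rev D / (2 m)`, the tail of `s` is at most `b / x` under `D`, so it is at
most `b / x + δ` under `Dp`. Integrating the tail gives `V ≥ exp (2 m - 1) * b`. For `m ≥ 3` and
`L = V / m`, the optimal prices of the independent items, which together must not sell the bundle
too well, earn hardly more than `b` each (`CloseToProduct.sum_price_le`), and the sum of all terms
stays below `2 m b`. For `m = 2` there is too little room for this. There the item prices `p` are
moreover played against each other: `p * 1(s ≥ p)` is subtracted from the capped payment before the
transfer, which replaces the revenue of `p` for the item by that for the bundle under `D`, at most
`b`. For `m = 1` there is no minor item, and `D` is itself a product.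

*Separate sales.* With `L = V / m ^ 6` the transfer costs only a small fraction of `Rev D`, the tails
of the items under `Dp` below `L` are `r i / x` with `∑ i, r i` close to `SRev D`, and all the terms
are of order `log m * SRev D` (`CloseToProduct.revenue_le_of_item_tails`).
-/


namespace SimpleVsOptimal

variable {m : ℕ}

/-! ### Layer-cake formula and total variation -/

theorem ae_of_isDistributionOn {T : Set (Fin m → ℝ)} {D : Measure (Fin m → ℝ)}
    (hD : IsDistributionOn T D) : ∀ᵐ t ∂D, t ∈ T := by
  rw [ae_iff]; exact hD.compl_null

theorem integrable_of_ae_bounded {Ω : Type*} [MeasurableSpace Ω] {P : Measure Ω}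
    [IsFiniteMeasure P] {f : Ω → ℝ} (hf : Measurable f) {lo hi : ℝ}
    (h : ∀ᵐ ω ∂P, f ω ∈ Set.Icc lo hi) : Integrable f P :=
  Integrable.of_mem_Icc lo hi hf.aemeasurable h

theorem antitone_tail {Ω : Type*} [MeasurableSpace Ω] (P : Measure Ω) [IsFiniteMeasure P]
    (f : Ω → ℝ) : Antitone fun x : ℝ => P.real {ω | x ≤ f ω} := fun _ _ h =>
  measureReal_mono (fun _ hω => le_trans h hω)

theorem integral_max_sub_eq {Ω : Type*} [MeasurableSpace Ω] {P : Measure Ω}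
    [IsFiniteMeasure P] {f : Ω → ℝ} (hf : Measurable f) {L V : ℝ} (hLV : L ≤ V)
    (h : ∀ᵐ ω ∂P, f ω ≤ V) :
    ∫ ω, max (f ω - L) 0 ∂P = ∫ x in L..V, P.real {ω | x ≤ f ω} := by
  have hint : Integrable (fun ω => max (f ω - L) 0) P := by
    refine integrable_of_ae_bounded (lo := 0) (hi := V - L) (by fun_prop) ?_
    filter_upwards [h] with ω hω
    exact ⟨le_max_right _ _, max_le (by linarith) (by linarith)⟩
  rw [hint.integral_eq_integral_Ioc_meas_le (M := V - L)
    (Filter.Eventually.of_forall fun ω => le_max_right _ _)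
    (by filter_upwards [h] with ω hω; exact max_le (by linarith) (by linarith))]
  have e : ∫ x in L..V, P.real {ω | x ≤ f ω}
      = ∫ x in (0 : ℝ)..(V - L), P.real {ω | x + L ≤ f ω} := by
    have := intervalIntegral.integral_comp_add_right
      (f := fun x : ℝ => P.real {ω | x ≤ f ω}) (a := 0) (b := V - L) L
    rw [this]; simp
  rw [e, intervalIntegral.integral_of_le (by linarith)]
  refine setIntegral_congr_fun measurableSet_Ioc fun x hx => ?_
  have : {ω | x ≤ max (f ω - L) 0} = {ω | x + L ≤ f ω} := by
    ext ω
    simp only [Set.mem_ofPred_eq, le_max_iff, not_le.mpr hx.1, or_false]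
    constructor <;> intro h <;> linarith
  simp only [this]

theorem integral_max_sub_le {Ω : Type*} [MeasurableSpace Ω] {P : Measure Ω}
    [IsFiniteMeasure P] {f : Ω → ℝ} (hf : Measurable f) {L V : ℝ} (hLV : L ≤ V)
    (h : ∀ᵐ ω ∂P, f ω ≤ V) {g : ℝ → ℝ} (hg : IntervalIntegrable g volume L V)
    (hle : ∀ x ∈ Set.Icc L V, P.real {ω | x ≤ f ω} ≤ g x) :
    ∫ ω, max (f ω - L) 0 ∂P ≤ ∫ x in L..V, g x := by
  rw [integral_max_sub_eq hf hLV h]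
  exact intervalIntegral.integral_mono_on hLV
    ((antitone_tail P f).antitoneOn _).intervalIntegrable hg hle

theorem integral_const_div {c L V : ℝ} (hL : 0 < L) (hLV : L ≤ V) :
    ∫ x in L..V, c / x = c * Real.log (V / L) := by
  have : (0 : ℝ) ∉ Set.uIcc L V := by
    rw [Set.uIcc_of_le hLV]; intro h; exact absurd h.1 (not_le.mpr hL)
  simp_rw [div_eq_mul_one_div c]
  rw [intervalIntegral.integral_const_mul, integral_one_div this]

theorem intervalIntegrable_const_div {c L V : ℝ} (hL : 0 < L) (hLV : L ≤ V) :
    IntervalIntegrable (fun x => c / x) volume L V := by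
  refine ContinuousOn.intervalIntegrable ?_
  rw [Set.uIcc_of_le hLV]
  exact continuousOn_const.div continuousOn_id fun x hx => (hL.trans_le hx.1).ne'

/-- The truncated mean of a function whose tail is at most `c / x`. -/
theorem integral_max_sub_le_log {Ω : Type*} [MeasurableSpace Ω] {P : Measure Ω}
    [IsFiniteMeasure P] {f : Ω → ℝ} (hf : Measurable f) {L V c : ℝ} (hL : 0 < L) (hLV : L ≤ V)
    (h : ∀ᵐ ω ∂P, f ω ≤ V) (hle : ∀ x ∈ Set.Icc L V, P.real {ω | x ≤ f ω} ≤ c / x) :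
    ∫ ω, max (f ω - L) 0 ∂P ≤ c * Real.log (V / L) := by
  rw [← integral_const_div hL hLV]
  exact integral_max_sub_le hf hLV h (intervalIntegrable_const_div hL hLV) hle

theorem abs_measureReal_sub_le_tvDist {Ω : Type*} [MeasurableSpace Ω] (P Q : Measure Ω)
    [IsProbabilityMeasure P] [IsProbabilityMeasure Q] {E : Set Ω} (hE : MeasurableSet E) :
    |P.real E - Q.real E| ≤ tvDist P Q := by
  refine le_ciSup (f := fun E : {E : Set Ω // MeasurableSet E} => |P.real E.1 - Q.real E.1|)
    ⟨1, ?_⟩ ⟨E, hE⟩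
  rintro _ ⟨F, rfl⟩
  have h1 := measureReal_le_one (μ := P) (s := F.1)
  have h2 := measureReal_le_one (μ := Q) (s := F.1)
  have h3 := measureReal_nonneg (μ := P) (s := F.1)
  have h4 := measureReal_nonneg (μ := Q) (s := F.1)
  exact abs_sub_le_iff.mpr ⟨by linarith, by linarith⟩

theorem tvDist_nonneg {Ω : Type*} [MeasurableSpace Ω] (P Q : Measure Ω) : 0 ≤ tvDist P Q :=
  Real.iSup_nonneg fun _ => abs_nonneg _

/-- Expectations of a function with values in `[lo, hi]` differ by at most `hi - lo` times the
total variation distance. -/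
theorem integral_sub_integral_le_tvDist {Ω : Type*} [MeasurableSpace Ω] {P Q : Measure Ω}
    [IsProbabilityMeasure P] [IsProbabilityMeasure Q] {f : Ω → ℝ} (hf : Measurable f)
    {lo hi : ℝ} (hlo : lo ≤ hi) (hP : ∀ᵐ ω ∂P, f ω ∈ Set.Icc lo hi)
    (hQ : ∀ᵐ ω ∂Q, f ω ∈ Set.Icc lo hi) :
    ∫ ω, f ω ∂P ≤ ∫ ω, f ω ∂Q + (hi - lo) * tvDist P Q := by
  have key : ∀ (S : Measure Ω) [IsProbabilityMeasure S], (∀ᵐ ω ∂S, f ω ∈ Set.Icc lo hi) →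
      ∫ ω, f ω ∂S = lo + ∫ x in lo..hi, S.real {ω | x ≤ f ω} := by
    intro S _ hS
    rw [← integral_max_sub_eq hf hlo (hS.mono fun ω h => h.2)]
    have : ∫ ω, max (f ω - lo) 0 ∂S = ∫ ω, (f ω - lo) ∂S := by
      refine integral_congr_ae ?_
      filter_upwards [hS] with ω hω
      exact max_eq_left (by linarith [hω.1])
    rw [this, integral_sub (integrable_of_ae_bounded hf hS) (integrable_const _)]
    simp
  rw [key P hP, key Q hQ]
  have : ∫ x in lo..hi, P.real {ω | x ≤ f ω}
      ≤ ∫ x in lo..hi, (Q.real {ω | x ≤ f ω} + tvDist P Q) := by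
    refine intervalIntegral.integral_mono_on hlo
      ((antitone_tail P f).antitoneOn _).intervalIntegrable
      (((antitone_tail Q f).antitoneOn _).intervalIntegrable.add intervalIntegrable_const) ?_
    intro x _
    have := (abs_le.mp (abs_measureReal_sub_le_tvDist P Q
      (measurableSet_le measurable_const hf : MeasurableSet {ω | x ≤ f ω}))).2
    linarith
  rw [intervalIntegral.integral_add ((antitone_tail Q f).antitoneOn _).intervalIntegrable
    intervalIntegrable_const, intervalIntegral.integral_const, smul_eq_mul] at this
  linarith

/-! ### Resampling one coordinate of a product measure -/

theorem measurable_update_prod (i : Fin m) :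
    Measurable fun z : (Fin m → ℝ) × ℝ => Function.update z.1 i z.2 := by
  rw [measurable_pi_iff]
  intro j
  by_cases h : j = i
  · subst h; simpa using measurable_snd
  · simp only [Function.update_of_ne h]
    exact (measurable_pi_apply j).comp measurable_fst

/-- Replacing a coordinate by an independent copy does not change a product measure. -/
theorem measurePreserving_update (ν : Fin m → Measure ℝ)
    [∀ i, IsProbabilityMeasure (ν i)] (i : Fin m) :
    MeasurePreserving (fun z : (Fin m → ℝ) × ℝ => Function.update z.1 i z.2)
      ((Measure.pi ν).prod (ν i)) (Measure.pi ν) := by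
  refine ⟨measurable_update_prod i, ?_⟩
  symm
  refine Measure.pi_eq fun s hs => ?_
  rw [Measure.map_apply (measurable_update_prod i) (MeasurableSet.univ_pi hs)]
  have : (fun z : (Fin m → ℝ) × ℝ => Function.update z.1 i z.2) ⁻¹' (Set.univ.pi s)
      = (Set.univ.pi (Function.update s i Set.univ)) ×ˢ s i := by
    ext z
    simp only [Set.mem_preimage, Set.mem_pi, Set.mem_univ, true_imp_iff, Set.mem_prod]
    constructor
    · intro h
      refine ⟨fun j => ?_, by simpa using h i⟩
      by_cases hj : j = i
      · subst hj; simp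
      · simpa [Function.update_of_ne hj] using h j
    · rintro ⟨h1, h2⟩ j
      by_cases hj : j = i
      · subst hj; simpa using h2
      · simpa [Function.update_of_ne hj] using h1 j
  rw [this, Measure.prod_prod, Measure.pi_pi]
  rw [← Finset.prod_erase_mul _ _ (Finset.mem_univ i),
    ← Finset.prod_erase_mul _ _ (Finset.mem_univ i)]
  simp only [Function.update_self, measure_univ, mul_one]
  congr 1
  refine Finset.prod_congr rfl fun j hj => ?_
  rw [Function.update_of_ne (Finset.ne_of_mem_erase hj)]

theorem integral_pi_eq_integral_update (ν : Fin m → Measure ℝ)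
    [∀ i, IsProbabilityMeasure (ν i)] (i : Fin m) {f : (Fin m → ℝ) → ℝ} (hm : Measurable f)
    (hf : Integrable f (Measure.pi ν)) :
    ∫ t, f t ∂(Measure.pi ν) = ∫ t, ∫ x, f (Function.update t i x) ∂(ν i) ∂(Measure.pi ν) := by
  have hp := measurePreserving_update ν i
  rw [← integral_prod (f := fun z : (Fin m → ℝ) × ℝ => f (Function.update z.1 i z.2))
    ((hp.integrable_comp hm.aestronglyMeasurable).mpr hf)]
  conv_lhs => rw [← hp.map_eq]
  rw [integral_map hp.measurable.aemeasurable hm.aestronglyMeasurable]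

theorem integrable_integral_update (ν : Fin m → Measure ℝ)
    [∀ i, IsProbabilityMeasure (ν i)] (i : Fin m) {f : (Fin m → ℝ) → ℝ} (hm : Measurable f)
    (hf : Integrable f (Measure.pi ν)) :
    Integrable (fun t => ∫ x, f (Function.update t i x) ∂(ν i)) (Measure.pi ν) :=
  (((measurePreserving_update ν i).integrable_comp hm.aestronglyMeasurable).mpr hf).integral_prod_left

theorem ae_ae_update (ν : Fin m → Measure ℝ)
    [∀ i, IsProbabilityMeasure (ν i)] (i : Fin m) {p : (Fin m → ℝ) → Prop}
    (h : ∀ᵐ t ∂(Measure.pi ν), p t) :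
    ∀ᵐ t ∂(Measure.pi ν), ∀ᵐ x ∂(ν i), p (Function.update t i x) :=
  Measure.ae_ae_of_ae_prod ((measurePreserving_update ν i).quasiMeasurePreserving.ae h)

theorem measureReal_pi_eval (ν : Fin m → Measure ℝ)
    [∀ i, IsProbabilityMeasure (ν i)] (i : Fin m) {s : Set ℝ} (hs : MeasurableSet s) :
    (Measure.pi ν).real {t | t i ∈ s} = (ν i).real s :=
  (measurePreserving_eval ν i).measureReal_preimage hs.nullMeasurableSet

/-! ### One-item slices of a mechanism -/

/-- Along one coordinate, an incentive compatible allocation `q` with utility `u` is, up to an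
error of order `1 / N`, a uniform mixture of `N` posted prices: the `k`-th price is the least
type whose allocation probability reaches `(k + 1) / N`. -/
theorem exists_prices_of_slice {S : Set ℝ} {q u : ℝ → ℝ} {V : ℝ} (hS : S ⊆ Set.Icc 0 V)
    (hq : ∀ x ∈ S, q x ∈ Set.Icc (0 : ℝ) 1) (hu : ∀ x ∈ S, 0 ≤ u x)
    (huq : ∀ x ∈ S, ∀ z ∈ S, u x + q x * (z - x) ≤ u z) {N : ℕ} (hN : 0 < N) :
    ∃ p : ℕ → ℝ, (∀ k, 0 ≤ p k) ∧ ∀ x ∈ S,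
      x * q x ≤ x / N + (1 / N : ℝ) * ∑ k ∈ Finset.range N, (if p k ≤ x then x else 0) ∧
      x * q x - u x ≤ x / N +
        (1 / N : ℝ) * ∑ k ∈ Finset.range N, (if p k ≤ x then p k else 0) := by
  classical
  have hN' : (0 : ℝ) < N := by exact_mod_cast hN
  set Sk : ℕ → Set ℝ := fun k => {x | x ∈ S ∧ ((k : ℝ) + 1) / N ≤ q x} with hSk
  have hbdd : ∀ k, BddBelow (Sk k) := fun k => ⟨0, fun x hx => (hS hx.1).1⟩
  set p : ℕ → ℝ := fun k => sInf (Sk k) with hp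
  have hp_le : ∀ k : ℕ, ∀ x ∈ S, ((k : ℝ) + 1) / N ≤ q x → p k ≤ x := fun k x hx h =>
    csInf_le (hbdd k) ⟨hx, h⟩
  have key : ∀ n : ℕ, ∀ y ∈ S, (n : ℝ) / N ≤ q y →
      ∑ k ∈ Finset.range n, (y - p k) ≤ N * u y := by
    intro n
    induction n with
    | zero => intro y hy _; simpa using mul_nonneg hN'.le (hu y hy)
    | succ n ih =>
      intro y hy hqy
      push_cast at hqy
      refine le_of_forall_pos_le_add fun ε hε => ?_
      obtain ⟨z, hz, hzlt⟩ := exists_lt_of_csInf_lt (⟨y, hy, hqy⟩ : (Sk n).Nonempty)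
        (show sInf (Sk n) < p n + ε / N by simp only [hp]; linarith [div_pos hε hN'])
      have hpz := hp_le n z hz.1 hz.2
      have hpy := hp_le n y hy hqy
      have h1 := ih z hz.1 (le_trans (by gcongr; linarith) hz.2)
      have h2 := huq z hz.1 y hy
      have h3 : (n : ℝ) + 1 ≤ N * q z := by
        have := hz.2
        rwa [div_le_iff₀ hN', mul_comm] at this
      have h4 := (hq z hz.1).2
      have h5 : N * (z - p n) ≤ ε := by
        have : z - p n ≤ ε / N := by linarith
        calc N * (z - p n) ≤ N * (ε / N) := by gcongr
          _ = ε := by field_simp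
      have h6 : ∑ k ∈ Finset.range n, (p n - p k) ≤ ∑ k ∈ Finset.range n, (z - p k) :=
        Finset.sum_le_sum fun k _ => by linarith
      have h7 : ∑ k ∈ Finset.range n, (y - p k)
          = ∑ k ∈ Finset.range n, (p n - p k) + n * (y - p n) := by
        rw [← sub_eq_iff_eq_add', ← Finset.sum_sub_distrib]
        simp [mul_sub]
      rw [Finset.sum_range_succ, h7]
      have h8 : N * (u z + q z * (y - z)) ≤ N * u y := by gcongr
      have h9 : ((n : ℝ) + 1) * (y - p n) ≤ N * q z * (y - p n) := by
        gcongr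
      have h10 : N * q z * (z - p n) ≤ ε := by
        have : q z * (N * (z - p n)) ≤ 1 * (N * (z - p n)) := by
          gcongr
        linarith
      linarith
  refine ⟨p, fun k => Real.sInf_nonneg fun x hx => (hS hx.1).1, fun x hx => ?_⟩
  have hx0 := (hS hx).1
  have hp0 : ∀ k, 0 ≤ p k := fun k => Real.sInf_nonneg fun x hx => (hS hx.1).1
  have hqx := hq x hx
  set j := ⌊N * q x⌋₊ with hj
  have hj1 : (j : ℝ) ≤ N * q x := Nat.floor_le (mul_nonneg hN'.le hqx.1)
  have hj2 : N * q x < j + 1 := Nat.lt_floor_add_one _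
  have hjN : j ≤ N := by
    have : (j : ℝ) ≤ N := hj1.trans (by nlinarith [hqx.2])
    exact_mod_cast this
  have hpx : ∀ k ∈ Finset.range j, p k ≤ x := by
    intro k hk
    refine hp_le k x hx ?_
    rw [div_le_iff₀ hN', mul_comm]
    have : (k : ℝ) + 1 ≤ j := by exact_mod_cast Finset.mem_range.mp hk
    linarith
  have hsub : Finset.range j ⊆ Finset.range N := Finset.range_mono hjN
  have hxq : x * q x ≤ x / N + (1 / N : ℝ) * (j * x) := by
    have : x * (N * q x) ≤ x * (j + 1) := by gcongr
    have h2 : x / N + (1 / N : ℝ) * (j * x) = x * (j + 1) / N := by field_simp; ring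
    rw [h2, le_div_iff₀ hN']; linarith
  constructor
  · refine hxq.trans ?_
    gcongr
    calc (j : ℝ) * x = ∑ k ∈ Finset.range j, (if p k ≤ x then x else 0) := by
          rw [Finset.sum_congr rfl fun k hk => if_pos (hpx k hk)]; simp
      _ ≤ _ := Finset.sum_le_sum_of_subset_of_nonneg hsub fun k _ _ => by split_ifs <;> linarith
  · have h1 := key j x hx (by rw [div_le_iff₀ hN']; linarith)
    have h2 : ∑ k ∈ Finset.range j, p k ≤ ∑ k ∈ Finset.range N, (if p k ≤ x then p k else 0) := by
      calc ∑ k ∈ Finset.range j, p k = ∑ k ∈ Finset.range j, (if p k ≤ x then p k else 0) :=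
            (Finset.sum_congr rfl fun k hk => if_pos (hpx k hk)).symm
        _ ≤ _ := Finset.sum_le_sum_of_subset_of_nonneg hsub fun k _ _ => by
            split_ifs
            exacts [hp0 k, le_rfl]
    rw [Finset.sum_sub_distrib] at h1
    simp only [Finset.sum_const, Finset.card_range, nsmul_eq_mul] at h1
    have h3 : (1 / N : ℝ) * (j * x) ≤ u x + (1 / N : ℝ) * ∑ k ∈ Finset.range j, p k := by
      have : (1 / N : ℝ) * (j * x) ≤ (1 / N : ℝ) * (N * u x + ∑ k ∈ Finset.range j, p k) := by
        gcongr; linarith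
      refine this.trans (le_of_eq ?_)
      field_simp
    have h4 : (1 / N : ℝ) * ∑ k ∈ Finset.range j, p k
        ≤ (1 / N : ℝ) * ∑ k ∈ Finset.range N, (if p k ≤ x then p k else 0) := by gcongr
    linarith

namespace Mechanism

/-- The probability that item `i` is allocated after the report `t`. -/
def itemProb (M : Mechanism m) (t : Fin m → ℝ) (i : Fin m) : ℝ :=
  ∑ A : Finset (Fin m), M.alloc t A * if i ∈ A then 1 else 0

theorem itemProb_mem (M : Mechanism m) (t : Fin m → ℝ) (i : Fin m) :
    M.itemProb t i ∈ Set.Icc (0 : ℝ) 1 := by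
  have h := M.alloc_mem t
  constructor
  · exact Finset.sum_nonneg fun A _ => mul_nonneg (h.1 A) (by split_ifs <;> norm_num)
  · rw [← h.2]
    refine Finset.sum_le_sum fun A _ => ?_
    have := h.1 A
    split_ifs <;> linarith

theorem measurable_itemProb (M : Mechanism m) (i : Fin m) :
    Measurable fun t => M.itemProb t i :=
  Finset.measurable_sum _ fun A _ =>
    ((measurable_pi_apply A).comp M.measurable_alloc).mul_const _

theorem utility_eq (M : Mechanism m) (t s : Fin m → ℝ) :
    M.utility t s = ∑ i, M.itemProb s i * t i - M.pay s := by
  unfold utility itemProb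
  congr 1
  simp_rw [Finset.sum_mul, Finset.mul_sum]
  rw [Finset.sum_comm]
  refine Finset.sum_congr rfl fun A _ => ?_
  rw [← Finset.sum_filter_add_sum_filter_not Finset.univ (fun i => i ∈ A)]
  rw [Finset.sum_eq_zero (s := Finset.univ.filter fun i => i ∉ A), add_zero]
  · rw [Finset.filter_mem_eq_inter, Finset.univ_inter]
    exact Finset.sum_congr rfl fun i hi => by simp [hi]
  · intro i hi
    simp [(Finset.mem_filter.mp hi).2]

theorem measurable_utility_self (M : Mechanism m) : Measurable fun t => M.utility t t := by
  simp_rw [utility_eq]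
  exact (Finset.measurable_sum _ fun i _ =>
    (M.measurable_itemProb i).mul (measurable_pi_apply i)).sub M.measurable_pay

theorem pay_eq (M : Mechanism m) (t : Fin m → ℝ) :
    M.pay t = ∑ i, M.itemProb t i * t i - M.utility t t := by
  rw [utility_eq]; ring

/-- A payment of a type never exceeds her value for all the items. -/
theorem pay_le_sum (M : Mechanism m) {V : ℝ} {T : Set (Fin m → ℝ)} (hT : IsTypeSpace V T)
    (hIR : M.IndividuallyRational T) {t : Fin m → ℝ} (ht : t ∈ T) : M.pay t ≤ ∑ i, t i := by
  rw [pay_eq]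
  have h1 : ∑ i, M.itemProb t i * t i ≤ ∑ i, t i := Finset.sum_le_sum fun i _ => by
    have h2 := (M.itemProb_mem t i).2
    have h3 := hT.nonneg t ht i
    nlinarith
  linarith [hIR t ht]

/-- Incentive compatibility along one coordinate: the allocation probability is a subgradient of the
utility. -/
theorem utility_update_le (M : Mechanism m) {T : Set (Fin m → ℝ)}
    (hIC : M.IncentiveCompatible T) (t : Fin m → ℝ) (i : Fin m) {x z : ℝ}
    (hx : Function.update t i x ∈ T) (hz : Function.update t i z ∈ T) :
    M.utility (Function.update t i x) (Function.update t i x)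
      + M.itemProb (Function.update t i x) i * (z - x)
      ≤ M.utility (Function.update t i z) (Function.update t i z) := by
  refine le_trans (le_of_eq ?_) (hIC _ hz _ hx)
  rw [utility_eq, utility_eq]
  rw [← Finset.sum_erase_add _ _ (Finset.mem_univ i),
    ← Finset.sum_erase_add (Finset.univ)
      (fun j => M.itemProb (Function.update t i x) j * Function.update t i z j)
      (Finset.mem_univ i)]
  have : ∑ j ∈ Finset.univ.erase i,
      M.itemProb (Function.update t i x) j * Function.update t i x j
      = ∑ j ∈ Finset.univ.erase i,
        M.itemProb (Function.update t i x) j * Function.update t i z j :=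
    Finset.sum_congr rfl fun j hj => by
      rw [Function.update_of_ne (Finset.ne_of_mem_erase hj),
        Function.update_of_ne (Finset.ne_of_mem_erase hj)]
  rw [this]
  simp only [Function.update_self]
  ring

end Mechanism

/-- Item `i` is the favorite of type `t`: it has the largest value, and ties are broken in favor
of the smallest index. -/
def IsFavorite (t : Fin m → ℝ) (i : Fin m) : Prop :=
  ∀ j, t j ≤ t i ∧ (j < i → t j < t i)

/-- Item `i` is not the favorite of type `t`, and all the values of `t` are below `L`. -/
def IsMinor (L : ℝ) (t : Fin m → ℝ) (i : Fin m) : Prop :=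
  ¬ IsFavorite t i ∧ ∀ j, t j < L

theorem measurableSet_isFavorite (i : Fin m) :
    MeasurableSet {t : Fin m → ℝ | IsFavorite t i} := by
  have : {t : Fin m → ℝ | IsFavorite t i}
      = ⋂ j, ({t | t j ≤ t i} ∩ if j < i then {t | t j < t i} else Set.univ) := by
    ext t
    simp only [IsFavorite, Set.mem_ofPred_eq, Set.mem_iInter, Set.mem_inter_iff]
    refine forall_congr' fun j => and_congr_right fun _ => ?_
    split_ifs with h <;> simp [h]
  rw [this]
  refine MeasurableSet.iInter fun j =>
    (measurableSet_le (measurable_pi_apply j) (measurable_pi_apply i)).inter ?_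
  split_ifs
  · exact measurableSet_lt (measurable_pi_apply j) (measurable_pi_apply i)
  · exact MeasurableSet.univ

theorem measurableSet_isMinor (L : ℝ) (i : Fin m) :
    MeasurableSet {t : Fin m → ℝ | IsMinor L t i} := by
  have : {t : Fin m → ℝ | IsMinor L t i}
      = {t | IsFavorite t i}ᶜ ∩ ⋂ j, {t | t j < L} := by
    ext t; simp [IsMinor]
  rw [this]
  exact (measurableSet_isFavorite i).compl.inter
    (MeasurableSet.iInter fun j => measurableSet_lt (measurable_pi_apply j) measurable_const)

theorem exists_isFavorite (hm : 0 < m) (t : Fin m → ℝ) : ∃ i, IsFavorite t i := by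
  classical
  have : Nonempty (Fin m) := ⟨⟨0, hm⟩⟩
  obtain ⟨i0, hi0⟩ := Finite.exists_max t
  set F := Finset.univ.filter fun i => ∀ j, t j ≤ t i with hF
  have hne : F.Nonempty := ⟨i0, by simp [hF, hi0]⟩
  refine ⟨F.min' hne, fun j => ?_⟩
  have hmem := F.min'_mem hne
  have h1 := (Finset.mem_filter.mp hmem).2
  refine ⟨h1 j, fun hj => lt_of_le_of_ne (h1 j) fun heq => ?_⟩
  have : j ∈ F := Finset.mem_filter.mpr ⟨Finset.mem_univ _, fun k => heq ▸ h1 k⟩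
  exact absurd (F.min'_le j this) (not_le.mpr hj)

/-! ### Revenue from a product distribution, less the value above a level -/

open Classical in
/-- The part of `t i` above `b`, counted only if item `i` is a minor item of type `t`. -/
noncomputable def minorExcess (L b : ℝ) (t : Fin m → ℝ) (i : Fin m) : ℝ :=
  if IsMinor L t i then max (t i - b) 0 else 0

theorem minorExcess_nonneg (L b : ℝ) (t : Fin m → ℝ) (i : Fin m) : 0 ≤ minorExcess L b t i := by
  unfold minorExcess
  split_ifs
  exacts [le_max_right _ _, le_rfl]

theorem measurable_minorExcess (L b : ℝ) (i : Fin m) :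
    Measurable fun t : Fin m → ℝ => minorExcess L b t i :=
  Measurable.ite (measurableSet_isMinor L i)
    (by fun_prop) measurable_const

/-- The contribution of a posted price `p` for one item of value `x` to the capped revenue: the
value itself is counted up to `b`, a payment at a price above `b` is reduced by the excess of the
value over `L`. -/
noncomputable def priceKernel (L b p x : ℝ) : ℝ :=
  if p ≤ b then min x b else if p ≤ x then max b (p - max (x - L) 0) else 0

theorem measurable_priceKernel (L b p : ℝ) : Measurable (priceKernel L b p) := by
  unfold priceKernel
  refine Measurable.ite (MeasurableSet.const _) (by fun_prop) ?_
  exact Measurable.ite (measurableSet_le measurable_const measurable_id) (by fun_prop)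
    measurable_const

theorem priceKernel_mem {L b p x : ℝ} (hb : 0 ≤ b) (hx : 0 ≤ x) :
    priceKernel L b p x ∈ Set.Icc 0 (max b p) := by
  unfold priceKernel
  split_ifs with h1 h2
  · exact ⟨le_min hx hb, (min_le_right _ _).trans (le_max_left _ _)⟩
  · exact ⟨hb.trans (le_max_left _ _), max_le_max le_rfl (by linarith [le_max_right (x - L) 0])⟩
  · exact ⟨le_rfl, hb.trans (le_max_left _ _)⟩

open Classical in
/-- The share of item `i` in the revenue of `M` from type `t`, less the value above `L`: a minor item
contributes its allocated value, and the favorite its own, less the utility and the excess over `L`.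
If some item is worth `L` or more, the items other than the favorite contribute nothing. -/
noncomputable def revenueShare (M : Mechanism m) (L : ℝ) (t : Fin m → ℝ) (i : Fin m) : ℝ :=
  if IsMinor L t i then t i * M.itemProb t i else
    if IsFavorite t i then
      max (t i * M.itemProb t i - M.utility t t - max (t i - L) 0) 0 else 0

theorem measurable_revenueShare (M : Mechanism m) (L : ℝ) (i : Fin m) :
    Measurable fun t => revenueShare M L t i := by
  refine Measurable.ite (measurableSet_isMinor L i)
    ((measurable_pi_apply i).mul (M.measurable_itemProb i)) ?_
  refine Measurable.ite (measurableSet_isFavorite i) ?_ measurable_const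
  exact ((((measurable_pi_apply i).mul (M.measurable_itemProb i)).sub
    M.measurable_utility_self).sub (((measurable_pi_apply i).sub_const L).max
      measurable_const)).max measurable_const

theorem type_mem_Icc {V : ℝ} {T : Set (Fin m → ℝ)} (hT : IsTypeSpace V T) {t : Fin m → ℝ}
    (ht : t ∈ T) (i : Fin m) : t i ∈ Set.Icc 0 V :=
  ⟨hT.nonneg t ht i, (Finset.single_le_sum (f := t) (fun j _ => hT.nonneg t ht j)
    (Finset.mem_univ i)).trans (hT.sum_le t ht)⟩

theorem minorExcess_le {V : ℝ} {T : Set (Fin m → ℝ)} (hT : IsTypeSpace V T) {L b : ℝ}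
    (hb : 0 ≤ b) {t : Fin m → ℝ} (ht : t ∈ T) (i : Fin m) : minorExcess L b t i ≤ V := by
  have h := type_mem_Icc hT ht i
  unfold minorExcess
  split_ifs
  exacts [max_le (by linarith [h.2]) (h.1.trans h.2), h.1.trans h.2]

theorem revenueShare_mem {M : Mechanism m} {V : ℝ} {T : Set (Fin m → ℝ)}
    (hT : IsTypeSpace V T) (hIR : M.IndividuallyRational T) (L : ℝ) {t : Fin m → ℝ} (ht : t ∈ T)
    (i : Fin m) : revenueShare M L t i ∈ Set.Icc 0 V := by
  have h := type_mem_Icc hT ht i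
  have hq := M.itemProb_mem t i
  have hu := hIR t ht
  have h1 : t i * M.itemProb t i ≤ t i := mul_le_of_le_one_right h.1 hq.2
  unfold revenueShare
  split_ifs
  · exact ⟨mul_nonneg h.1 hq.1, h1.trans h.2⟩
  · exact ⟨le_max_right _ _,
      max_le (by linarith [le_max_right (t i - L) 0, h.2]) (h.1.trans h.2)⟩
  · exact ⟨le_rfl, h.1.trans h.2⟩

/-- If every posted price for item `i` has expected kernel at most `Val`, then so does, up to the
minor excess, the share of item `i` in the revenue, for all fixed values of the other items. -/
theorem integral_revenueShare_update_le {M : Mechanism m} {V : ℝ} {T : Set (Fin m → ℝ)}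
    (hT : IsTypeSpace V T) (hIC : M.IncentiveCompatible T) (hIR : M.IndividuallyRational T)
    {L b : ℝ} (hb : 0 ≤ b) (i : Fin m) {P : Measure ℝ} [IsProbabilityMeasure P] {Val : ℝ}
    (hV0 : 0 ≤ V) (hmin : ∫ x, min x b ∂P ≤ Val)
    (hmax : ∀ p, b < p → p ≤ V → ∫ x, priceKernel L b p x ∂P ≤ Val) {t : Fin m → ℝ}
    (ht : ∀ᵐ x ∂P, Function.update t i x ∈ T) :
    ∫ x, revenueShare M L (Function.update t i x) i ∂P
      ≤ Val + ∫ x, minorExcess L b (Function.update t i x) i ∂P := by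
  set U : ℝ → Fin m → ℝ := fun x => Function.update t i x with hU
  have hUi : ∀ x, U x i = x := fun x => Function.update_self i x t
  have hUm : Measurable U := measurable_update t
  set S : Set ℝ := {x | U x ∈ T} with hSdef
  have hS : S ⊆ Set.Icc 0 V := fun x hx => by
    have := type_mem_Icc hT (t := U x) hx i
    rwa [hUi] at this
  have hP0 : ∀ᵐ x ∂P, x ∈ Set.Icc 0 V := ht.mono fun x hx => hS hx
  have hker : ∀ p, Integrable (priceKernel L b p) P := fun p =>
    integrable_of_ae_bounded (measurable_priceKernel L b p)
      (hP0.mono fun x hx => priceKernel_mem hb hx.1)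
  have hval : ∀ p, ∫ x, priceKernel L b p x ∂P ≤ Val := by
    intro p
    rcases le_or_gt p b with h | h
    · simpa only [priceKernel, if_pos h] using hmin
    rcases le_or_gt p V with h' | h'
    · exact hmax p h h'
    · have h0 : ∫ x, priceKernel L b p x ∂P = 0 := by
        refine integral_eq_zero_of_ae (hP0.mono fun x hx => ?_)
        simp only [priceKernel, if_neg (not_le.mpr h), Pi.zero_apply]
        rw [if_neg]
        linarith [hx.2]
      rw [h0]
      refine le_trans (integral_nonneg_of_ae (hP0.mono fun x hx => ?_)) hmin
      exact le_min hx.1 hb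
  have hexc : Integrable (fun x => minorExcess L b (U x) i) P :=
    integrable_of_ae_bounded (lo := 0) (hi := V) ((measurable_minorExcess L b i).comp hUm)
      (ht.mono fun x hx => ⟨minorExcess_nonneg _ _ _ _, minorExcess_le hT hb hx i⟩)
  have main : ∀ N : ℕ, 0 < N → ∫ x, revenueShare M L (U x) i ∂P
      ≤ V / N + (Val + ∫ x, minorExcess L b (U x) i ∂P) := by
    intro N hN
    have hN' : (0 : ℝ) < N := by exact_mod_cast hN
    obtain ⟨p, hp0, hp⟩ := exists_prices_of_slice hS (q := fun x => M.itemProb (U x) i)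
      (u := fun x => M.utility (U x) (U x)) (fun x _ => M.itemProb_mem _ _)
      (fun x hx => hIR _ hx) (fun x hx z hz => M.utility_update_le hIC t i hx hz) hN
    have hsumint : Integrable (fun x => (1 / N : ℝ) *
        ∑ k ∈ Finset.range N, priceKernel L b (p k) x) P :=
      (integrable_finsetSum _ fun k _ => hker (p k)).const_mul _
    have hle : ∀ x ∈ S, revenueShare M L (U x) i ≤
        (V / N + (1 / N : ℝ) * ∑ k ∈ Finset.range N, priceKernel L b (p k) x)
          + minorExcess L b (U x) i := by
      intro x hx
      have hx0 := (hS hx).1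
      have hxV := (hS hx).2
      obtain ⟨h1, h2⟩ := hp x hx
      have hxN : x / N ≤ V / N := by gcongr
      have hker0 : ∀ k, 0 ≤ priceKernel L b (p k) x := fun k => (priceKernel_mem hb hx0).1
      have hsum0 : 0 ≤ ∑ k ∈ Finset.range N, priceKernel L b (p k) x :=
        Finset.sum_nonneg fun k _ => hker0 k
      have hVN : 0 ≤ V / N := by positivity
      unfold revenueShare minorExcess
      simp only [hUi]
      split_ifs with h3 h4
      · have : ∑ k ∈ Finset.range N, (if p k ≤ x then x else 0) ≤
            ∑ k ∈ Finset.range N, (priceKernel L b (p k) x + max (x - b) 0) := by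
          refine Finset.sum_le_sum fun k _ => ?_
          unfold priceKernel
          have e1 := le_max_left (x - b) 0
          have e2 := le_max_right (x - b) 0
          split_ifs with g1 g2 g2
          · rcases min_cases x b with h | h <;> linarith
          · linarith [le_max_left b (p k - max (x - L) 0)]
          · linarith [le_min hx0 hb]
          · linarith
        rw [Finset.sum_add_distrib] at this
        simp only [Finset.sum_const, Finset.card_range, nsmul_eq_mul] at this
        have h5 : (1 / N : ℝ) * ∑ k ∈ Finset.range N, (if p k ≤ x then x else 0) ≤
            (1 / N : ℝ) * ∑ k ∈ Finset.range N, priceKernel L b (p k) x + max (x - b) 0 := by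
          refine (mul_le_mul_of_nonneg_left this (by positivity)).trans (le_of_eq ?_)
          field_simp
        linarith
      · rw [add_zero]
        refine max_le ?_ (by positivity)
        have : ∑ k ∈ Finset.range N, (if p k ≤ x then p k else 0) ≤
            ∑ k ∈ Finset.range N, (priceKernel L b (p k) x + max (x - L) 0) := by
          refine Finset.sum_le_sum fun k _ => ?_
          have e2 := le_max_right (x - L) 0
          have := hker0 k
          unfold priceKernel at this ⊢
          split_ifs at this ⊢ with g1 g2 g2
          · rcases min_cases x b with h | h <;> linarith
          · linarith [le_max_right b (p k - max (x - L) 0)]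
          · linarith
          · linarith
        rw [Finset.sum_add_distrib] at this
        simp only [Finset.sum_const, Finset.card_range, nsmul_eq_mul] at this
        have h5 : (1 / N : ℝ) * ∑ k ∈ Finset.range N, (if p k ≤ x then p k else 0) ≤
            (1 / N : ℝ) * ∑ k ∈ Finset.range N, priceKernel L b (p k) x + max (x - L) 0 := by
          refine (mul_le_mul_of_nonneg_left this (by positivity)).trans (le_of_eq ?_)
          field_simp
        linarith
      · positivity
    calc ∫ x, revenueShare M L (U x) i ∂P
        ≤ ∫ x, ((V / N + (1 / N : ℝ) * ∑ k ∈ Finset.range N, priceKernel L b (p k) x)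
          + minorExcess L b (U x) i) ∂P :=
          integral_mono_of_nonneg (ht.mono fun x hx => (revenueShare_mem hT hIR L hx i).1)
            (((integrable_const _).add hsumint).add hexc) (ht.mono fun x hx => hle x hx)
      _ = V / N + (1 / N : ℝ) * ∑ k ∈ Finset.range N, ∫ x, priceKernel L b (p k) x ∂P
          + ∫ x, minorExcess L b (U x) i ∂P := by
          have e := integral_add ((integrable_const (V / N : ℝ)).add hsumint) hexc
          simp only [Pi.add_apply] at e
          rw [e, integral_add (integrable_const _) hsumint, integral_const_mul,
            integral_finsetSum _ fun k _ => hker (p k)]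
          simp
      _ ≤ V / N + (1 / N : ℝ) * (N * Val) + ∫ x, minorExcess L b (U x) i ∂P := by
          gcongr
          refine (Finset.sum_le_sum fun k _ => hval (p k)).trans (le_of_eq ?_)
          simp
      _ = _ := by field_simp; ring
  refine le_of_forall_pos_le_add fun ε hε => ?_
  obtain ⟨N, hN⟩ := exists_nat_gt (V / ε)
  have hN0 : 0 < N := by
    have : (0 : ℝ) < N := (div_nonneg hV0 hε.le).trans_lt hN
    exact_mod_cast this
  have hN' : (0 : ℝ) < N := by exact_mod_cast hN0
  have h := main N hN0
  have : V / N ≤ ε := by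
    rw [div_le_iff₀ hN']
    rw [div_lt_iff₀ hε] at hN
    linarith
  linarith

/-- The revenue of a type exceeds her value above `L` by at most the sum of the shares. -/
theorem max_pay_sub_le_sum_revenueShare {M : Mechanism m} {V : ℝ} {T : Set (Fin m → ℝ)}
    (hT : IsTypeSpace V T) (hIR : M.IndividuallyRational T) (L : ℝ) {t : Fin m → ℝ}
    (hm : 0 < m) (ht : t ∈ T) :
    max (M.pay t - max (∑ i, t i - L) 0) 0 ≤ ∑ i, revenueShare M L t i := by
  have hW : ∀ i, 0 ≤ revenueShare M L t i := fun i => (revenueShare_mem hT hIR L ht i).1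
  refine max_le ?_ (Finset.sum_nonneg fun i _ => hW i)
  obtain ⟨i, hi⟩ := exists_isFavorite hm t
  have hnm : ¬ IsMinor L t i := fun h => h.1 hi
  have hWi : t i * M.itemProb t i - M.utility t t - max (t i - L) 0 ≤ revenueShare M L t i := by
    rw [revenueShare, if_neg hnm, if_pos hi]
    exact le_max_left _ _
  have hs : ∑ j, t j = ∑ j ∈ Finset.univ.erase i, t j + t i :=
    (Finset.sum_erase_add _ _ (Finset.mem_univ i)).symm
  have hp : M.pay t = ∑ j ∈ Finset.univ.erase i, M.itemProb t j * t j + M.itemProb t i * t i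
      - M.utility t t := by
    rw [M.pay_eq, Finset.sum_erase_add _ _ (Finset.mem_univ i)]
  rcases le_or_gt L (t i) with h | h
  · have h1 : revenueShare M L t i ≤ ∑ j, revenueShare M L t j :=
      Finset.single_le_sum (f := fun j => revenueShare M L t j) (fun j _ => hW j)
        (Finset.mem_univ i)
    have h2 : ∑ j ∈ Finset.univ.erase i, M.itemProb t j * t j
        ≤ ∑ j ∈ Finset.univ.erase i, t j := Finset.sum_le_sum fun j _ =>
      mul_le_of_le_one_left (hT.nonneg t ht j) (M.itemProb_mem t j).2
    rw [max_eq_left (by linarith)] at hWi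
    have h3 := le_max_left (∑ j, t j - L) 0
    linarith
  · rw [max_eq_right (by linarith)] at hWi
    have h3 := le_max_right (∑ j, t j - L) 0
    have hsum : ∑ j, revenueShare M L t j
        = ∑ j ∈ Finset.univ.erase i, revenueShare M L t j + revenueShare M L t i :=
      (Finset.sum_erase_add _ _ (Finset.mem_univ i)).symm
    have h2 : ∑ j ∈ Finset.univ.erase i, M.itemProb t j * t j
        ≤ ∑ j ∈ Finset.univ.erase i, revenueShare M L t j := by
      refine Finset.sum_le_sum fun j hj => ?_
      have hjm : IsMinor L t j := by
        refine ⟨fun hj' => ?_, fun k => (hi k).1.trans_lt h⟩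
        rcases lt_or_gt_of_ne (Finset.ne_of_mem_erase hj) with hlt | hlt
        · exact absurd (hj' i).1 (not_le.mpr ((hi j).2 hlt))
        · exact absurd (hi j).1 (not_le.mpr ((hj' i).2 hlt))
      rw [revenueShare, if_pos hjm, mul_comm]
    linarith

/-- Under a product distribution, the revenue above the value exceeding `L` is at most a sum of
one-item revenues and the minor excess. -/
theorem integral_max_pay_sub_le {M : Mechanism m} {V : ℝ} {T : Set (Fin m → ℝ)}
    (hT : IsTypeSpace V T) (hIC : M.IncentiveCompatible T) (hIR : M.IndividuallyRational T)
    (hm : 0 < m) (hV0 : 0 ≤ V) {L b : ℝ} (hb : 0 ≤ b) {ν : Fin m → Measure ℝ}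
    [∀ i, IsProbabilityMeasure (ν i)] (hν : ∀ᵐ t ∂(Measure.pi ν), t ∈ T) {Val : Fin m → ℝ}
    (hmin : ∀ i, ∫ x, min x b ∂(ν i) ≤ Val i)
    (hmax : ∀ i p, b < p → p ≤ V → ∫ x, priceKernel L b p x ∂(ν i) ≤ Val i) :
    ∫ t, max (M.pay t - max (∑ i, t i - L) 0) 0 ∂(Measure.pi ν)
      ≤ ∑ i, Val i + ∫ t, ∑ i, minorExcess L b t i ∂(Measure.pi ν) := by
  have hWint : ∀ i, Integrable (fun t => revenueShare M L t i) (Measure.pi ν) := fun i =>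
    integrable_of_ae_bounded (measurable_revenueShare M L i)
      (hν.mono fun t ht => revenueShare_mem hT hIR L ht i)
  have hEint : ∀ i, Integrable (fun t => minorExcess L b t i) (Measure.pi ν) := fun i =>
    integrable_of_ae_bounded (lo := 0) (hi := V) (measurable_minorExcess L b i)
      (hν.mono fun t ht => ⟨minorExcess_nonneg _ _ _ _, minorExcess_le hT hb ht i⟩)
  have hone : ∀ i, ∫ t, revenueShare M L t i ∂(Measure.pi ν)
      ≤ Val i + ∫ t, minorExcess L b t i ∂(Measure.pi ν) := by
    intro i
    rw [integral_pi_eq_integral_update ν i (measurable_revenueShare M L i) (hWint i),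
      integral_pi_eq_integral_update ν i (measurable_minorExcess L b i) (hEint i)]
    have hE := integrable_integral_update ν i (measurable_minorExcess L b i) (hEint i)
    have hW := integrable_integral_update ν i (measurable_revenueShare M L i) (hWint i)
    calc _ ≤ ∫ t, (Val i + ∫ x, minorExcess L b (Function.update t i x) i ∂(ν i))
          ∂(Measure.pi ν) := by
          refine integral_mono_ae hW ((integrable_const _).add hE) ?_
          filter_upwards [ae_ae_update ν i hν] with t ht
          exact integral_revenueShare_update_le hT hIC hIR hb i hV0 (hmin i) (hmax i) ht
      _ = _ := by
          rw [integral_add (integrable_const _) hE]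
          simp
  calc _ ≤ ∫ t, ∑ i, revenueShare M L t i ∂(Measure.pi ν) := by
        refine integral_mono_of_nonneg (Filter.Eventually.of_forall fun t => le_max_right _ _)
          (integrable_finsetSum _ fun i _ => hWint i) ?_
        exact hν.mono fun t ht => max_pay_sub_le_sum_revenueShare hT hIR L hm ht
    _ = ∑ i, ∫ t, revenueShare M L t i ∂(Measure.pi ν) := integral_finsetSum _ fun i _ => hWint i
    _ ≤ ∑ i, (Val i + ∫ t, minorExcess L b t i ∂(Measure.pi ν)) :=
        Finset.sum_le_sum fun i _ => hone i
    _ = _ := by rw [Finset.sum_add_distrib, integral_finsetSum _ fun i _ => hEint i]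

/-! ### Transfer of the revenue from a nearby product distribution -/

/-- The distribution `D` of types in `T` is within total variation distance `δ` of the product
of the one-item distributions `ν`, which is also supported on `T`. -/
structure CloseToProduct (V : ℝ) (T : Set (Fin m → ℝ)) (D : Measure (Fin m → ℝ))
    (ν : Fin m → Measure ℝ) (δ : ℝ) : Prop where
  typeSpace : IsTypeSpace V T
  prob : IsProbabilityMeasure D
  prob_item : ∀ i, IsProbabilityMeasure (ν i)
  mem : ∀ᵐ t ∂D, t ∈ T
  mem_pi : ∀ᵐ t ∂(Measure.pi ν), t ∈ T
  tv_le : tvDist D (Measure.pi ν) ≤ δ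

theorem sum_type_mem {V : ℝ} {T : Set (Fin m → ℝ)} (hT : IsTypeSpace V T) {t : Fin m → ℝ}
    (ht : t ∈ T) : ∑ i, t i ∈ Set.Icc 0 V :=
  ⟨Finset.sum_nonneg fun i _ => hT.nonneg t ht i, hT.sum_le t ht⟩

theorem measurable_sum_type : Measurable fun t : Fin m → ℝ => ∑ i, t i :=
  Finset.measurable_sum _ fun i _ => measurable_pi_apply i

theorem measurableSet_le_sum_type (p : ℝ) : MeasurableSet {t : Fin m → ℝ | p ≤ ∑ i, t i} :=
  measurableSet_le measurable_const measurable_sum_type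

namespace CloseToProduct

variable {V δ : ℝ} {T : Set (Fin m → ℝ)} {D : Measure (Fin m → ℝ)} {ν : Fin m → Measure ℝ}

theorem nonneg (h : CloseToProduct V T D ν δ) : 0 ≤ V := by
  have := h.prob
  obtain ⟨t, ht⟩ := h.mem.exists
  have := sum_type_mem h.typeSpace ht
  exact this.1.trans this.2

theorem real_pi_le (h : CloseToProduct V T D ν δ) {E : Set (Fin m → ℝ)} (hE : MeasurableSet E) :
    (Measure.pi ν).real E ≤ D.real E + δ := by
  have := h.prob
  have := h.prob_item
  have h1 := (abs_le.mp (abs_measureReal_sub_le_tvDist D (Measure.pi ν) hE)).1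
  linarith [h.tv_le]

/-- The capped payment `max (pay - max (s - L) 0) 0`, where `s` is the value of all the items, is
corrected by the payments `∑ p i` of posted bundle prices before it is transferred from the
product distribution to `D`: a bundle price earns at least as much under the product distribution
as the same price for the item alone. The correction shrinks the range of the transferred function
to `[-∑ p i, O - ∑ p i]`. -/
theorem integral_pay_le (h : CloseToProduct V T D ν δ) {M : Mechanism m}
    (hIC : M.IncentiveCompatible T) (hIR : M.IndividuallyRational T) (hm : 0 < m)
    {L b O : ℝ} (hb : 0 ≤ b) {Val p : Fin m → ℝ}
    (hmin : ∀ i, ∫ x, min x b ∂(ν i) ≤ Val i)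
    (hmax : ∀ i q, b < q → q ≤ V → ∫ x, priceKernel L b q x ∂(ν i) ≤ Val i)
    (hO : ∀ s ∈ Set.Icc 0 V, min s L + ∑ i, (if p i ≤ s then 0 else p i) ≤ O) (hL : 0 ≤ L)
    (hp : ∀ i, 0 ≤ p i) :
    M.revenue D ≤ ∫ t, max (∑ i, t i - L) 0 ∂D
      + ∑ i, (Val i + p i * (D.real {t | p i ≤ ∑ j, t j}
          - (Measure.pi ν).real {t | p i ≤ ∑ j, t j}))
      + ∫ t, ∑ i, minorExcess L b t i ∂(Measure.pi ν) + δ * O := by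
  have := h.prob
  have := h.prob_item
  have hV := h.nonneg
  set B : (Fin m → ℝ) → ℝ := fun t => max (M.pay t - max (∑ i, t i - L) 0) 0 with hB
  set F : (Fin m → ℝ) → ℝ := fun t => ∑ i, (if p i ≤ ∑ j, t j then p i else 0) with hF
  have hBm : Measurable B :=
    (M.measurable_pay.sub ((measurable_sum_type.sub_const L).max measurable_const)).max
      measurable_const
  have hFm : Measurable F := Finset.measurable_sum _ fun i _ =>
    Measurable.ite (measurableSet_le_sum_type (p i)) measurable_const measurable_const
  have hFsum : ∀ t, F t = ∑ i, p i - ∑ i, (if p i ≤ ∑ j, t j then 0 else p i) := fun t => by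
    rw [hF, ← Finset.sum_sub_distrib]
    refine Finset.sum_congr rfl fun i _ => ?_
    split_ifs <;> ring
  have hBb : ∀ t ∈ T, B t ∈ Set.Icc 0 (min (∑ i, t i) L) := by
    intro t ht
    refine ⟨le_max_right _ _, max_le ?_ (le_min (sum_type_mem h.typeSpace ht).1 hL)⟩
    have h1 := M.pay_le_sum h.typeSpace hIR ht
    rcases le_total (∑ i, t i) L with h2 | h2
    · rw [min_eq_left h2]; linarith [le_max_right (∑ i, t i - L) 0]
    · rw [min_eq_right h2]; linarith [le_max_left (∑ i, t i - L) 0]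
  have hBFb : ∀ t ∈ T, B t - F t ∈ Set.Icc (-∑ i, p i) (O - ∑ i, p i) := by
    intro t ht
    have h1 := hBb t ht
    have h2 := hO _ (sum_type_mem h.typeSpace ht)
    have h3 := hFsum t
    have h4 : 0 ≤ ∑ i, (if p i ≤ ∑ j, t j then 0 else p i) := Finset.sum_nonneg fun i _ => by
      split_ifs
      exacts [le_rfl, hp i]
    exact ⟨by linarith [h1.1], by linarith [h1.2]⟩
  have hFb : ∀ t, F t ∈ Set.Icc 0 (∑ i, p i) := fun t =>
    ⟨Finset.sum_nonneg fun i _ => by split_ifs; exacts [hp i, le_rfl],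
      Finset.sum_le_sum fun i _ => by split_ifs; exacts [le_rfl, hp i]⟩
  have hO0 : 0 ≤ O := by
    refine le_trans ?_ (hO 0 ⟨le_rfl, hV⟩)
    refine add_nonneg (le_min le_rfl hL) (Finset.sum_nonneg fun i _ => ?_)
    split_ifs
    exacts [le_rfl, hp i]
  have htv := integral_sub_integral_le_tvDist (P := D) (Q := Measure.pi ν) (hBm.sub hFm)
    (lo := -∑ i, p i) (hi := O - ∑ i, p i) (by linarith)
    (h.mem.mono fun t ht => hBFb t ht) (h.mem_pi.mono fun t ht => hBFb t ht)
  have hBint : ∀ (S : Measure (Fin m → ℝ)) [IsProbabilityMeasure S], (∀ᵐ t ∂S, t ∈ T) →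
      Integrable B S := fun S _ hS =>
    integrable_of_ae_bounded (lo := 0) (hi := L) hBm
      (hS.mono fun t ht => ⟨(hBb t ht).1, (hBb t ht).2.trans (min_le_right _ _)⟩)
  have hFint : ∀ (S : Measure (Fin m → ℝ)) [IsProbabilityMeasure S], Integrable F S := fun S _ =>
    integrable_of_ae_bounded hFm (Filter.Eventually.of_forall hFb)
  have hFeq : ∀ (S : Measure (Fin m → ℝ)) [IsProbabilityMeasure S],
      ∫ t, F t ∂S = ∑ i, p i * S.real {t | p i ≤ ∑ j, t j} := by
    intro S _
    rw [hF, integral_finsetSum _ fun i _ => ?_]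
    · refine Finset.sum_congr rfl fun i _ => ?_
      have : (fun t : Fin m → ℝ => if p i ≤ ∑ j, t j then p i else 0)
          = {t : Fin m → ℝ | p i ≤ ∑ j, t j}.indicator fun _ => p i := by
        ext t; simp [Set.indicator_apply]
      rw [this, integral_indicator_const _ (measurableSet_le_sum_type _), smul_eq_mul, mul_comm]
    · refine integrable_of_ae_bounded (lo := 0) (hi := p i)
        (Measurable.ite (measurableSet_le_sum_type (p i)) measurable_const measurable_const)
        (Filter.Eventually.of_forall fun t => ?_)
      split_ifs
      exacts [⟨hp i, le_rfl⟩, ⟨le_rfl, hp i⟩]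
  have hsint : Integrable (fun t => max (∑ i, t i - L) 0) D :=
    integrable_of_ae_bounded (lo := 0) (hi := V)
      ((measurable_sum_type.sub_const L).max measurable_const) (h.mem.mono fun t ht =>
        ⟨le_max_right _ _, max_le (by linarith [(sum_type_mem h.typeSpace ht).2]) hV⟩)
  have hpay : M.revenue D ≤ ∫ t, max (∑ i, t i - L) 0 ∂D + ∫ t, B t ∂D := by
    rw [← integral_add hsint (hBint D h.mem)]
    by_cases hi : Integrable M.pay D
    · refine integral_mono hi (hsint.add (hBint D h.mem)) fun t => ?_
      have := le_max_left (M.pay t - max (∑ i, t i - L) 0) 0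
      simp only [hB]
      linarith
    · rw [Mechanism.revenue, integral_undef hi]
      exact integral_nonneg fun t => add_nonneg (le_max_right _ _) (le_max_right _ _)
  simp only [Pi.sub_apply] at htv
  rw [integral_sub (hBint D h.mem) (hFint D), integral_sub (hBint _ h.mem_pi) (hFint _),
    hFeq, hFeq] at htv
  have hcore := integral_max_pay_sub_le h.typeSpace hIC hIR hm hV (L := L) hb h.mem_pi hmin hmax
  have hfin : (O - ∑ i, p i - -∑ i, p i) * tvDist D (Measure.pi ν) ≤ δ * O := by
    have : O - ∑ i, p i - -∑ i, p i = O := by ring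
    rw [this, mul_comm]
    exact mul_le_mul_of_nonneg_right h.tv_le hO0
  simp only [mul_sub, Finset.sum_add_distrib, Finset.sum_sub_distrib]
  linarith

end CloseToProduct

/-! ### The minor excess -/

/-- The expected number of minor items of value at least `x`. -/
noncomputable def minorTail (P : Measure (Fin m → ℝ)) (L x : ℝ) : ℝ :=
  ∑ i, P.real {t | IsMinor L t i ∧ x ≤ t i}

theorem measurableSet_isMinor_le (L x : ℝ) (i : Fin m) :
    MeasurableSet {t : Fin m → ℝ | IsMinor L t i ∧ x ≤ t i} :=
  (measurableSet_isMinor L i).inter (measurableSet_le measurable_const (measurable_pi_apply i))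

theorem antitone_minorTail (P : Measure (Fin m → ℝ)) [IsFiniteMeasure P] (L : ℝ) :
    Antitone (minorTail P L) := fun _ _ hxy =>
  Finset.sum_le_sum fun _ _ => measureReal_mono fun _ ht => ⟨ht.1, hxy.trans ht.2⟩

theorem IsMinor.le_half {V : ℝ} {T : Set (Fin m → ℝ)} (hT : IsTypeSpace V T) {t : Fin m → ℝ}
    (ht : t ∈ T) {L : ℝ} {i : Fin m} (hi : IsMinor L t i) : t i ≤ V / 2 := by
  obtain ⟨j, hj⟩ := exists_isFavorite i.pos t
  have hij : i ≠ j := fun e => hi.1 (e ▸ hj)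
  have h1 : ∑ k ∈ ({i, j} : Finset (Fin m)), t k ≤ ∑ k, t k :=
    Finset.sum_le_sum_of_subset_of_nonneg (Finset.subset_univ _) fun k _ _ => hT.nonneg t ht k
  rw [Finset.sum_pair hij] at h1
  linarith [(hj i).1, hT.sum_le t ht]

theorem integral_minorExcess_eq {P : Measure (Fin m → ℝ)} [IsProbabilityMeasure P] {V : ℝ}
    {T : Set (Fin m → ℝ)} (hT : IsTypeSpace V T) (hP : ∀ᵐ t ∂P, t ∈ T) {L b l : ℝ} (hb : 0 < b)
    (hbl : b ≤ l) (hl : ∀ t ∈ T, ∀ i, IsMinor L t i → t i ≤ l) :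
    ∫ t, ∑ i, minorExcess L b t i ∂P = ∫ x in b..l, minorTail P L x := by
  classical
  set f : Fin m → (Fin m → ℝ) → ℝ := fun i t => if IsMinor L t i then t i else 0 with hf
  have hfm : ∀ i, Measurable (f i) := fun i =>
    Measurable.ite (measurableSet_isMinor L i) (measurable_pi_apply i) measurable_const
  have hfl : ∀ i, ∀ᵐ t ∂P, f i t ≤ l := fun i => hP.mono fun t ht => by
    simp only [hf]
    split_ifs with h
    exacts [hl t ht i h, hb.le.trans hbl]
  have hE : ∀ i t, minorExcess L b t i = max (f i t - b) 0 := fun i t => by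
    simp only [hf, minorExcess]
    split_ifs
    · rfl
    · rw [max_eq_right (by linarith)]
  have hEint : ∀ i, Integrable (fun t => minorExcess L b t i) P := fun i =>
    integrable_of_ae_bounded (lo := 0) (hi := V) (measurable_minorExcess L b i)
      (hP.mono fun t ht => ⟨minorExcess_nonneg _ _ _ _, minorExcess_le hT hb.le ht i⟩)
  rw [integral_finsetSum _ fun i _ => hEint i]
  simp only [minorTail]
  rw [intervalIntegral.integral_finsetSum fun i _ => ?_]
  · refine Finset.sum_congr rfl fun i _ => ?_
    simp only [hE]
    rw [integral_max_sub_eq (hfm i) hbl (hfl i)]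
    refine intervalIntegral.integral_congr fun x hx => ?_
    rw [Set.uIcc_of_le hbl] at hx
    have : {t | x ≤ f i t} = {t | IsMinor L t i ∧ x ≤ t i} := by
      ext t
      simp only [hf, Set.mem_ofPred_eq]
      split_ifs with h
      · simp [h]
      · simp only [h, false_and, iff_false, not_le]; linarith [hx.1]
    simp only [this]
  · have : Antitone fun x : ℝ => P.real {t : Fin m → ℝ | IsMinor L t i ∧ x ≤ t i} :=
      fun _ _ hxy => measureReal_mono fun _ ht => ⟨ht.1, hxy.trans ht.2⟩
    exact (this.antitoneOn _).intervalIntegrable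

theorem sum_measureReal_eq_integral {P : Measure (Fin m → ℝ)} [IsProbabilityMeasure P]
    {ι : Type*} (s : Finset ι) {E : ι → Set (Fin m → ℝ)} (hE : ∀ i, MeasurableSet (E i)) :
    Integrable (fun t => ∑ i ∈ s, (E i).indicator (fun _ => (1 : ℝ)) t) P ∧
    ∑ i ∈ s, P.real (E i) = ∫ t, ∑ i ∈ s, (E i).indicator (fun _ => (1 : ℝ)) t ∂P := by
  have h : ∀ i ∈ s, Integrable ((E i).indicator fun _ => (1 : ℝ)) P := fun i _ =>
    (integrable_const _).indicator (hE i)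
  refine ⟨integrable_finsetSum _ h, ?_⟩
  rw [integral_finsetSum _ h]
  exact Finset.sum_congr rfl fun i _ => by
    rw [integral_indicator_const _ (hE i), smul_eq_mul, mul_one]

/-- If `k` minor items have value at least `x`, then so does the favorite, and all the items
together are worth at least `(k + 1) * x`. -/
theorem minorTail_le_sum_tail {P : Measure (Fin m → ℝ)} [IsProbabilityMeasure P] {V : ℝ}
    {T : Set (Fin m → ℝ)} (hT : IsTypeSpace V T) (hP : ∀ᵐ t ∂P, t ∈ T) (L : ℝ) {x : ℝ}
    (hx : 0 < x) :
    minorTail P L x ≤ ∑ k ∈ Finset.Icc 2 m, P.real {t | (k : ℝ) * x ≤ ∑ i, t i} := by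
  classical
  obtain ⟨hi1, he1⟩ := sum_measureReal_eq_integral (P := P) Finset.univ
    (measurableSet_isMinor_le L x)
  obtain ⟨hi2, he2⟩ := sum_measureReal_eq_integral (P := P) (Finset.Icc 2 m)
    (E := fun k : ℕ => {t : Fin m → ℝ | (k : ℝ) * x ≤ ∑ i, t i})
    (fun k => measurableSet_le_sum_type _)
  rw [minorTail, he1, he2]
  refine integral_mono_ae hi1 hi2 (hP.mono fun t ht => ?_)
  simp only [Set.indicator_apply, Set.mem_ofPred_eq, Finset.sum_boole, Nat.cast_le]
  set F := Finset.univ.filter fun i => IsMinor L t i ∧ x ≤ t i with hF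
  rcases F.eq_empty_or_nonempty with h0 | ⟨i0, hi0⟩
  · rw [h0]; simp
  obtain ⟨j, hj⟩ := exists_isFavorite i0.pos t
  have hjF : j ∉ F := fun h => (Finset.mem_filter.mp h).2.1.1 hj
  have hxi : ∀ i ∈ insert j F, x ≤ t i := by
    intro i hi
    rcases Finset.mem_insert.mp hi with rfl | hi
    · exact (Finset.mem_filter.mp hi0).2.2.trans (hj i0).1
    · exact (Finset.mem_filter.mp hi).2.2
  have hsum : ((F.card : ℝ) + 1) * x ≤ ∑ i, t i := by
    calc ((F.card : ℝ) + 1) * x = ∑ i ∈ insert j F, x := by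
          rw [Finset.sum_const, Finset.card_insert_of_notMem hjF]; simp
      _ ≤ ∑ i ∈ insert j F, t i := Finset.sum_le_sum hxi
      _ ≤ _ := Finset.sum_le_sum_of_subset_of_nonneg (Finset.subset_univ _)
          fun k _ _ => hT.nonneg t ht k
  have hcard : F.card + 1 ≤ m := by
    have := Finset.card_le_univ (insert j F)
    rwa [Finset.card_insert_of_notMem hjF, Fintype.card_fin] at this
  calc F.card = (Finset.Icc 2 (F.card + 1)).card := by simp
    _ ≤ _ := Finset.card_le_card fun k hk => by
      rw [Finset.mem_Icc] at hk
      refine Finset.mem_filter.mpr ⟨Finset.mem_Icc.mpr ⟨hk.1, hk.2.trans hcard⟩, ?_⟩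
      have : (k : ℝ) ≤ (F.card : ℝ) + 1 := by exact_mod_cast hk.2
      exact (mul_le_mul_of_nonneg_right this hx.le).trans hsum

section Product

variable (ν : Fin m → Measure ℝ) [∀ i, IsProbabilityMeasure (ν i)]

theorem real_pi_forall_lt (J : Finset (Fin m)) (p : Fin m → ℝ) :
    (Measure.pi ν).real {t | ∀ i ∈ J, t i < p i} = ∏ i ∈ J, (1 - (ν i).real (Set.Ici (p i))) := by
  classical
  have : {t : Fin m → ℝ | ∀ i ∈ J, t i < p i}
      = Set.univ.pi fun i => if i ∈ J then Set.Iio (p i) else Set.univ := by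
    ext t
    simp only [Set.mem_ofPred_eq, Set.mem_pi, Set.mem_univ, true_imp_iff]
    refine forall_congr' fun i => ?_
    split_ifs with h <;> simp [h]
  rw [this, measureReal_def, Measure.pi_pi, ENNReal.toReal_prod]
  rw [← Finset.prod_subset (Finset.subset_univ J)]
  · refine Finset.prod_congr rfl fun i hi => ?_
    rw [if_pos hi, ← measureReal_def, ← Set.compl_Ici, measureReal_compl measurableSet_Ici]
    simp
  · intro i _ hi
    simp [hi]

/-- If one of the items sells at a price above `c`, then all the items are worth at least `c`. -/
theorem one_sub_prod_le_tail {V : ℝ} {T : Set (Fin m → ℝ)} (hT : IsTypeSpace V T)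
    (hν : ∀ᵐ t ∂(Measure.pi ν), t ∈ T) (J : Finset (Fin m)) (p : Fin m → ℝ) {c : ℝ}
    (hc : ∀ i ∈ J, c ≤ p i) :
    1 - ∏ i ∈ J, (1 - (ν i).real (Set.Ici (p i))) ≤ (Measure.pi ν).real {t | c ≤ ∑ i, t i} := by
  have hms : MeasurableSet {t : Fin m → ℝ | ∀ i ∈ J, t i < p i} := by
    simp only [Set.ofPred_forall]
    exact MeasurableSet.iInter fun i => MeasurableSet.iInter fun _ =>
      measurableSet_lt (measurable_pi_apply i) measurable_const
  rw [← real_pi_forall_lt ν J p, ← probReal_compl_eq_one_sub hms]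
  refine ENNReal.toReal_mono (by finiteness) (measure_mono_ae ?_)
  filter_upwards [hν] with t ht htJ
  obtain ⟨i, hi, hti⟩ : ∃ i ∈ J, p i ≤ t i := by
    by_contra! hcon
    exact htJ hcon
  exact (hc i hi).trans (hti.trans (Finset.single_le_sum (f := t)
    (fun j _ => hT.nonneg t ht j) (Finset.mem_univ i)))

/-- Discounting the favorite leaves the expected number of valuable items minus the probability
that there is one. -/
theorem minorTail_pi_le (L x : ℝ) :
    minorTail (Measure.pi ν) L x
      ≤ ∑ i, (ν i).real (Set.Ici x) - (1 - ∏ i, (1 - (ν i).real (Set.Ici x))) := by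
  classical
  have hE : ∀ i : Fin m, MeasurableSet {t : Fin m → ℝ | t i ∈ Set.Ici x} := fun i =>
    measurable_pi_apply i measurableSet_Ici
  obtain ⟨hi1, he1⟩ := sum_measureReal_eq_integral (P := Measure.pi ν) Finset.univ
    (measurableSet_isMinor_le L x)
  obtain ⟨hi2, he2⟩ := sum_measureReal_eq_integral (P := Measure.pi ν) Finset.univ hE
  have hms : MeasurableSet {t : Fin m → ℝ | ∀ i ∈ Finset.univ, t i < x} := by
    simp only [Set.ofPred_forall]
    exact MeasurableSet.iInter fun i => MeasurableSet.iInter fun _ =>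
      measurableSet_lt (measurable_pi_apply i) measurable_const
  have hi3 : Integrable ({t : Fin m → ℝ | ∀ i ∈ Finset.univ, t i < x}ᶜ.indicator
      fun _ => (1 : ℝ)) (Measure.pi ν) := (integrable_const _).indicator hms.compl
  simp_rw [← measureReal_pi_eval ν _ (measurableSet_Ici (a := x))]
  have e3 := real_pi_forall_lt ν Finset.univ fun _ => x
  simp_rw [← measureReal_pi_eval ν _ (measurableSet_Ici (a := x))] at e3
  rw [← e3, ← probReal_compl_eq_one_sub hms, minorTail, he1, he2, ← mul_one (Measure.real _ _),
    ← smul_eq_mul, ← integral_indicator_const _ hms.compl, ← integral_sub hi2 hi3]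
  refine integral_mono hi1 (hi2.sub hi3) fun t => ?_
  simp only [Set.indicator_apply, Set.mem_ofPred_eq, Finset.sum_boole, Set.mem_Ici,
    Set.mem_compl_iff, ite_not]
  split_ifs with h
  · rw [sub_zero]
    exact_mod_cast Finset.card_le_card fun i hi => by
      simpa using (Finset.mem_filter.mp hi).2.2
  · obtain ⟨i0, hi0⟩ : ∃ i, x ≤ t i := by
      by_contra! hcon
      exact h fun i _ => hcon i
    obtain ⟨j, hj⟩ := exists_isFavorite i0.pos t
    have hsub : (Finset.univ.filter fun i => IsMinor L t i ∧ x ≤ t i)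
        ⊆ (Finset.univ.filter fun i => x ≤ t i).erase j := fun i hi => by
      obtain ⟨h1, h2⟩ := (Finset.mem_filter.mp hi).2
      exact Finset.mem_erase.mpr ⟨fun e => h1.1 (e ▸ hj), by simp [h2]⟩
    have hjm : j ∈ Finset.univ.filter fun i => x ≤ t i := by simp [hi0.trans (hj i0).1]
    have h1 := Finset.card_le_card hsub
    have h2 := Finset.card_erase_add_one hjm
    have h3 : (Finset.univ.filter fun i => IsMinor L t i ∧ x ≤ t i).card + 1
        ≤ (Finset.univ.filter fun i => x ≤ t i).card := by omega
    have h4 : ((Finset.univ.filter fun i => IsMinor L t i ∧ x ≤ t i).card : ℝ) + 1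
        ≤ (Finset.univ.filter fun i => x ≤ t i).card := by exact_mod_cast h3
    linarith

end Product

/-! ### Independent events: expected number against probability of occurrence -/

theorem prod_one_sub_mem {ι : Type*} (s : Finset ι) {h : ι → ℝ}
    (hh : ∀ i, h i ∈ Set.Icc (0 : ℝ) 1) : ∏ i ∈ s, (1 - h i) ∈ Set.Icc (0 : ℝ) 1 :=
  ⟨Finset.prod_nonneg fun i _ => by linarith [(hh i).2],
    Finset.prod_le_one (fun i _ => by linarith [(hh i).2]) fun i _ => by linarith [(hh i).1]⟩

/-- The expected number of independent events of probabilities `h i` exceeds the probability that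
one of them occurs only to second order. -/
theorem sum_sub_le_half_sq {ι : Type*} (s : Finset ι) {h : ι → ℝ}
    (hh : ∀ i, h i ∈ Set.Icc (0 : ℝ) 1) :
    ∑ i ∈ s, h i - (1 - ∏ i ∈ s, (1 - h i)) ≤ (∑ i ∈ s, h i) ^ 2 / 2 := by
  classical
  induction s using Finset.induction_on with
  | empty => simp
  | insert a s ha ih =>
    rw [Finset.sum_insert ha, Finset.prod_insert ha]
    have h1 := hh a
    have h2 : 0 ≤ ∑ i ∈ s, h i := Finset.sum_nonneg fun i _ => (hh i).1
    set S := ∑ i ∈ s, h i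
    set Q := ∏ i ∈ s, (1 - h i)
    have h3 : (1 - h a) * Q ≤ (1 - h a) * (1 - S + S ^ 2 / 2) :=
      mul_le_mul_of_nonneg_left (by linarith) (by linarith [h1.2])
    nlinarith [mul_nonneg h1.1 (sq_nonneg S), sq_nonneg (h a)]

/-- Of two independent events with `w` the probability that one occurs, the worst case is that of
equal probabilities `1 - √(1 - w)`. -/
theorem sum_sub_le_sq_two {h : Fin 2 → ℝ} (hh : ∀ i, h i ∈ Set.Icc (0 : ℝ) 1)
    (hw : 1 - ∏ i, (1 - h i) ≤ 0.7167) :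
    ∑ i, h i - (1 - ∏ i, (1 - h i)) ≤ 0.43 * (1 - ∏ i, (1 - h i)) ^ 2 := by
  simp only [Fin.prod_univ_two, Fin.sum_univ_two] at *
  have h0 := hh 0
  have h1 := hh 1
  generalize h 0 = a at *
  generalize h 1 = c at *
  set w := 1 - (1 - a) * (1 - c) with hwdef
  have he : a + c - w = a * c := by rw [hwdef]; ring
  rw [he]
  set e := a * c with hedef
  have hs : a + c = w + e := by linarith
  have hew : e ≤ w := by nlinarith [h0.1, h0.2, h1.1, h1.2]
  have he0 : 0 ≤ e := mul_nonneg h0.1 h1.1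
  have hw0 : 0 ≤ w := he0.trans hew
  have hq : 0 ≤ (w + e) ^ 2 - 4 * e := by
    rw [← hs, hedef]; nlinarith [sq_nonneg (a - c)]
  by_contra! hcon
  -- `(w + e) ^ 2 - 4 * e` is convex in `e`, and is not positive at `0.43 * w ^ 2` and at `w`
  have hwpos : 0 < w := by
    rcases hw0.eq_or_lt with h | h
    · rw [← h] at hew hcon; norm_num at hcon; linarith
    · exact h
  have hf : (1 + 0.43 * w) ^ 2 ≤ 4 * 0.43 := by nlinarith
  have hf' : (w + 0.43 * w ^ 2) ^ 2 ≤ 4 * (0.43 * w ^ 2) := by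
    have : (w + 0.43 * w ^ 2) ^ 2 = w ^ 2 * (1 + 0.43 * w) ^ 2 := by ring
    rw [this]; nlinarith [sq_nonneg w]
  have hg : 4 * w * (w - 1) < 0 := by nlinarith
  have hlt : 0.43 * w ^ 2 < w := by nlinarith
  nlinarith [mul_nonneg (sub_nonneg.mpr hew) (sub_nonneg.mpr hcon.le),
    mul_pos (sub_pos.mpr hcon) (sub_pos.mpr hlt)]

/-- For three events, the inequality of means reduces the claim to equal probabilities. -/
theorem sum_sub_le_sq_three {h : Fin 3 → ℝ} (hh : ∀ i, h i ∈ Set.Icc (0 : ℝ) 1)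
    (hw : 1 - ∏ i, (1 - h i) ≤ 0.677) :
    ∑ i, h i - (1 - ∏ i, (1 - h i)) ≤ 0.59 * (1 - ∏ i, (1 - h i)) ^ 2 := by
  have hmem := prod_one_sub_mem Finset.univ hh
  have hamgm : ∏ i, (1 - h i) ≤ ((3 - ∑ i, h i) / 3) ^ 3 := by
    simp only [Fin.prod_univ_three, Fin.sum_univ_three]
    have h0 := hh 0
    have h1 := hh 1
    have h2 := hh 2
    generalize h 0 = a at *
    generalize h 1 = c at *
    generalize h 2 = d at *
    nlinarith [mul_nonneg (sub_nonneg.mpr h0.2) (sq_nonneg (c - d)),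
      mul_nonneg (sub_nonneg.mpr h1.2) (sq_nonneg (a - d)),
      mul_nonneg (sub_nonneg.mpr h2.2) (sq_nonneg (a - c)),
      mul_nonneg (add_nonneg (add_nonneg (sub_nonneg.mpr h0.2) (sub_nonneg.mpr h1.2))
        (sub_nonneg.mpr h2.2)) (add_nonneg (add_nonneg (sq_nonneg (a - c)) (sq_nonneg (c - d)))
        (sq_nonneg (a - d)))]
  set w := 1 - ∏ i, (1 - h i) with hwdef
  have hw0 : 0 ≤ w := by linarith [hmem.2]
  by_contra! hcon
  set z := (1 + 0.59 * w) / 3 with hz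
  have hlt : ((3 - ∑ i, h i) / 3) ^ 3 < (1 - w * z) ^ 3 :=
    Odd.strictMono_pow (by decide) (by rw [hz]; nlinarith)
  have hkey : 3 * z ^ 2 - w * z ^ 3 ≤ 0.59 := by
    rw [hz]
    nlinarith [mul_nonneg hw0 (sub_nonneg.mpr hw), mul_nonneg (mul_nonneg hw0 hw0) hw0,
      mul_nonneg (mul_nonneg hw0 hw0) (sub_nonneg.mpr hw)]
  have hle : (1 - w * z) ^ 3 ≤ 1 - w := by
    have : 1 - w - (1 - w * z) ^ 3 = w * (3 * z - 1 - w * (3 * z ^ 2 - w * z ^ 3)) := by ring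
    have h3 : 3 * z - 1 = 0.59 * w := by rw [hz]; ring
    have h4 : w * (3 * z ^ 2 - w * z ^ 3) ≤ w * 0.59 := mul_le_mul_of_nonneg_left hkey hw0
    have : 0 ≤ w * (3 * z - 1 - w * (3 * z ^ 2 - w * z ^ 3)) :=
      mul_nonneg hw0 (by linarith)
    linarith
  linarith

/-- For any number of events, `∏ i, (1 - h i) ≤ exp (-∑ i, h i)` is used. -/
theorem sum_sub_le_sq {h : Fin m → ℝ} (hh : ∀ i, h i ∈ Set.Icc (0 : ℝ) 1)
    (hw : 1 - ∏ i, (1 - h i) ≤ 0.502) :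
    ∑ i, h i - (1 - ∏ i, (1 - h i)) ≤ 0.8 * (1 - ∏ i, (1 - h i)) ^ 2 := by
  have hmem := prod_one_sub_mem Finset.univ hh
  have hexp : ∏ i, (1 - h i) ≤ Real.exp (-∑ i, h i) := by
    rw [← Finset.sum_neg_distrib, Real.exp_sum]
    exact Finset.prod_le_prod (fun i _ => by linarith [(hh i).2]) fun i _ => by
      linarith [Real.add_one_le_exp (-h i)]
  set w := 1 - ∏ i, (1 - h i) with hwdef
  have hw0 : 0 ≤ w := by linarith [hmem.2]
  by_contra! hcon
  set a := w + 0.8 * w ^ 2 with ha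
  have ha0 : 0 ≤ a := by positivity
  have h1 : 1 - w < Real.exp (-a) := by
    have : Real.exp (-∑ i, h i) < Real.exp (-a) := Real.exp_lt_exp.mpr (by linarith)
    linarith
  have h2 : 1 + a + a ^ 2 / 2 + a ^ 3 / 6 ≤ Real.exp a := by
    have := Real.sum_le_exp_of_nonneg ha0 4
    simp only [Finset.sum_range_succ, Finset.sum_range_zero, Nat.factorial] at this
    norm_num at this
    linarith
  have h3 : (1 - w) * Real.exp a < 1 := by
    have := mul_lt_mul_of_pos_right h1 (Real.exp_pos a)
    rwa [← Real.exp_add, neg_add_cancel, Real.exp_zero] at this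
  have h4 : 1 ≤ (1 - w) * (1 + a + a ^ 2 / 2 + a ^ 3 / 6) := by
    have p2 : w ^ 2 ≤ 0.502 ^ 2 := by gcongr
    have p3 : w ^ 3 ≤ 0.502 ^ 3 := by gcongr
    have p4 : w ^ 4 ≤ 0.502 ^ 4 := by gcongr
    have p5 : w ^ 5 ≤ 0.502 ^ 5 := by gcongr
    have e : (1 - w) * (1 + a + a ^ 2 / 2 + a ^ 3 / 6) - 1 = w ^ 2 * (3 / 10 - w / 3
        - 37 / 150 * w ^ 2 - 2 / 5 * w ^ 3 - 88 / 375 * w ^ 4 - 32 / 375 * w ^ 5) := by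
      rw [ha]; ring
    have : 0 ≤ w ^ 2 * (3 / 10 - w / 3
        - 37 / 150 * w ^ 2 - 2 / 5 * w ^ 3 - 88 / 375 * w ^ 4 - 32 / 375 * w ^ 5) := by
      refine mul_nonneg (sq_nonneg w) ?_
      norm_num at p2 p3 p4 p5 hw
      linarith
    linarith
  have h5 : (1 - w) * (1 + a + a ^ 2 / 2 + a ^ 3 / 6) ≤ (1 - w) * Real.exp a :=
    mul_le_mul_of_nonneg_left h2 (by linarith)
  linarith

/-! ### Bounds on the minor excess -/

theorem integral_sq_div_add {b δ c l : ℝ} (hc : 0 < c) (hcl : c ≤ l) :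
    ∫ x in c..l, (b / x + δ) ^ 2
      = b ^ 2 * (1 / c - 1 / l) + 2 * b * δ * Real.log (l / c) + δ ^ 2 * (l - c) := by
  have hl : 0 < l := hc.trans_le hcl
  have hpos : ∀ x ∈ Set.uIcc c l, 0 < x := fun x hx => by
    rw [Set.uIcc_of_le hcl] at hx; exact hc.trans_le hx.1
  rw [intervalIntegral.integral_eq_sub_of_hasDerivAt
    (f := fun x => -(b ^ 2 * x⁻¹) + 2 * b * δ * Real.log x + δ ^ 2 * x)]
  · rw [Real.log_div hl.ne' hc.ne']
    field_simp
    ring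
  · intro x hx
    have hx0 := (hpos x hx).ne'
    have h := ((((hasDerivAt_inv hx0).const_mul (b ^ 2)).neg).add
      ((Real.hasDerivAt_log hx0).const_mul (2 * b * δ))).add ((hasDerivAt_id x).const_mul (δ ^ 2))
    refine h.congr_deriv ?_
    field_simp
    ring
  · refine ContinuousOn.intervalIntegrable fun x hx => ?_
    have hx0 := (hpos x hx).ne'
    exact ContinuousAt.continuousWithinAt (by fun_prop (disch := exact hx0))

namespace CloseToProduct

variable {V δ : ℝ} {T : Set (Fin m → ℝ)} {D : Measure (Fin m → ℝ)} {ν : Fin m → Measure ℝ}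

/-- The tails of the bundle value under the product distribution, given those under `D`. -/
theorem real_pi_sum_le (h : CloseToProduct V T D ν δ) {b : ℝ}
    (hb : ∀ x, 0 < x → D.real {t | x ≤ ∑ i, t i} ≤ b / x) {x : ℝ} (hx : 0 < x) :
    (Measure.pi ν).real {t | x ≤ ∑ i, t i} ≤ b / x + δ :=
  (h.real_pi_le (measurableSet_le_sum_type x)).trans (by linarith [hb x hx])

/-- Below `x₁ * b` the number of minor items is bounded through the bundle value, and above through
independence: the expected number of valuable items exceeds the probability that there is one
only to second order. -/
theorem integral_minorExcess_le (h : CloseToProduct V T D ν δ) (hm : 0 < m) {b : ℝ} (hb0 : 0 < b)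
    (hδ : 0 ≤ δ) (hb : ∀ x, 0 < x → D.real {t | x ≤ ∑ i, t i} ≤ b / x) (L : ℝ) {x₁ y κ : ℝ}
    (hx₁ : 1 ≤ x₁) (hxV : x₁ * b ≤ V / 2) (hy : 1 / x₁ + δ ≤ y) (hκ0 : 0 ≤ κ)
    (hκ : ∀ h : Fin m → ℝ, (∀ i, h i ∈ Set.Icc (0 : ℝ) 1) → 1 - ∏ i, (1 - h i) ≤ y →
      ∑ i, h i - (1 - ∏ i, (1 - h i)) ≤ κ * (1 - ∏ i, (1 - h i)) ^ 2) :
    ∫ t, ∑ i, minorExcess L b t i ∂(Measure.pi ν)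
      ≤ b * (∑ k ∈ Finset.Icc 2 m, 1 / (k : ℝ)) * Real.log x₁ + (m - 1) * (x₁ - 1) * b * δ
        + κ * (b ^ 2 * (1 / (x₁ * b) - 2 / V) + 2 * b * δ * Real.log (V / (2 * x₁ * b))
          + δ ^ 2 * (V / 2 - x₁ * b)) := by
  have := h.prob_item
  have hx0 : 0 < x₁ := by linarith
  have hc : 0 < x₁ * b := by positivity
  have hbc : b ≤ x₁ * b := by nlinarith
  have hV : 0 < V := by linarith
  have hanti := antitone_minorTail (Measure.pi ν) L
  have hii : ∀ a c, IntervalIntegrable (minorTail (Measure.pi ν) L) volume a c := fun a c =>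
    (hanti.antitoneOn _).intervalIntegrable
  rw [integral_minorExcess_eq h.typeSpace h.mem_pi hb0 (hbc.trans hxV)
    (fun t ht i hi => hi.le_half h.typeSpace ht),
    ← intervalIntegral.integral_add_adjacent_intervals (hii b (x₁ * b)) (hii _ _)]
  have hG := fun x hx => h.real_pi_sum_le hb (x := x) hx
  refine add_le_add ?_ ?_
  · set C := ∑ k ∈ Finset.Icc 2 m, 1 / (k : ℝ) with hC
    have hint := intervalIntegrable_const_div (c := b * C) hb0 hbc
    calc ∫ x in b..(x₁ * b), minorTail (Measure.pi ν) L x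
        ≤ ∫ x in b..(x₁ * b), (b * C / x + (m - 1) * δ) := by
          refine intervalIntegral.integral_mono_on hbc (hii _ _)
            (hint.add intervalIntegrable_const) fun x hx => ?_
          have hx' : 0 < x := hb0.trans_le hx.1
          refine (minorTail_le_sum_tail h.typeSpace h.mem_pi L hx').trans ?_
          have : ∀ k ∈ Finset.Icc 2 m, (Measure.pi ν).real {t | (k : ℝ) * x ≤ ∑ i, t i}
              ≤ b / x * (1 / (k : ℝ)) + δ := fun k hk => by
            have hk0 : (0 : ℝ) < k := by
              have := (Finset.mem_Icc.mp hk).1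
              exact_mod_cast (by omega : 0 < k)
            refine (hG _ (mul_pos hk0 hx')).trans (le_of_eq ?_)
            field_simp
          refine (Finset.sum_le_sum this).trans (le_of_eq ?_)
          rw [Finset.sum_add_distrib, ← Finset.mul_sum, ← hC]
          simp only [Finset.sum_const, Nat.card_Icc, nsmul_eq_mul]
          have e : ((m + 1 - 2 : ℕ) : ℝ) = m - 1 := by
            rw [show m + 1 - 2 = m - 1 by omega, Nat.cast_sub hm]; simp
          rw [e]; ring
      _ = _ := by
          rw [intervalIntegral.integral_add hint intervalIntegrable_const,
            integral_const_div hb0 hbc, intervalIntegral.integral_const, smul_eq_mul,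
            mul_div_assoc, div_self hb0.ne', mul_one]
          ring
  · have hint : IntervalIntegrable (fun x => κ * (b / x + δ) ^ 2) volume (x₁ * b) (V / 2) := by
      refine ContinuousOn.intervalIntegrable fun x hx => ?_
      rw [Set.uIcc_of_le hxV] at hx
      have hx0 : x ≠ 0 := (hc.trans_le hx.1).ne'
      exact ContinuousAt.continuousWithinAt (by fun_prop (disch := exact hx0))
    calc ∫ x in (x₁ * b)..(V / 2), minorTail (Measure.pi ν) L x
        ≤ ∫ x in (x₁ * b)..(V / 2), κ * (b / x + δ) ^ 2 := by
          refine intervalIntegral.integral_mono_on hxV (hii _ _) hint fun x hx => ?_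
          have hx' : 0 < x := hc.trans_le hx.1
          have hmem : ∀ i, (ν i).real (Set.Ici x) ∈ Set.Icc (0 : ℝ) 1 := fun i =>
            ⟨measureReal_nonneg, measureReal_le_one⟩
          have h1 := (one_sub_prod_le_tail ν h.typeSpace h.mem_pi Finset.univ (fun _ => x)
            (c := x) fun _ _ => le_rfl).trans (hG x hx')
          have h2 : b / x + δ ≤ y := by
            have : b / x ≤ b / (x₁ * b) := div_le_div_of_nonneg_left hb0.le hc hx.1
            have e : b / (x₁ * b) = 1 / x₁ := by field_simp
            linarith
          refine (minorTail_pi_le ν L x).trans ((hκ _ hmem (h1.trans h2)).trans ?_)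
          have h3 := (prod_one_sub_mem Finset.univ hmem).2
          gcongr
      _ = _ := by
          rw [intervalIntegral.integral_const_mul, integral_sq_div_add hc hxV]
          congr 3
          · congr 2
            field_simp
          · congr 2
            field_simp

end CloseToProduct

/-! ### Optimal posted prices for single items -/

/-- The price kernel above `b` is dominated by the revenue of the price, or of the price `L`. -/
theorem integral_priceKernel_le {P : Measure ℝ} [IsProbabilityMeasure P] {L b q : ℝ}
    (hb : 0 ≤ b) (hbq : b < q) (c : ℝ) (hc : max b (q - max (q - L) 0) ≤ c) :
    ∫ x, priceKernel L b q x ∂P ≤ c * P.real (Set.Ici q) := by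
  have h : ∫ x, (Set.Ici q).indicator (fun _ => c) x ∂P = c * P.real (Set.Ici q) := by
    rw [integral_indicator_const _ measurableSet_Ici, smul_eq_mul, mul_comm]
  rw [← h]
  refine integral_mono_of_nonneg (Filter.Eventually.of_forall fun x => ?_)
    ((integrable_const _).indicator measurableSet_Ici) (Filter.Eventually.of_forall fun x => ?_)
  · simp only [priceKernel, if_neg (not_le.mpr hbq), Pi.zero_apply]
    split_ifs
    exacts [hb.trans (le_max_left _ _), le_rfl]
  · simp only [priceKernel, if_neg (not_le.mpr hbq), Set.indicator_apply, Set.mem_Ici]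
    split_ifs with hx
    · refine le_trans ?_ hc
      gcongr
    · exact le_rfl

theorem integral_min_le {P : Measure ℝ} [IsProbabilityMeasure P] {b : ℝ} (hb : 0 ≤ b)
    (hP : ∀ᵐ x ∂P, 0 ≤ x) : ∫ x, min x b ∂P ≤ b := by
  have := integral_mono_ae (μ := P) (f := fun x => min x b) (g := fun _ => b)
    (integrable_of_ae_bounded (lo := 0) (hi := b) (by fun_prop)
      (hP.mono fun x hx => ⟨le_min hx hb, min_le_right _ _⟩))
    (integrable_const _) (Filter.Eventually.of_forall fun x => min_le_right _ _)
  simpa using this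

/-- Either all prices in `[b, l]` earn at most `b`, or one of them earns more than `b` and is optimal
in this range up to `ε`. -/
theorem exists_nearly_optimal_price (P : Measure ℝ) [IsProbabilityMeasure P] {b l ε : ℝ}
    (hε : 0 < ε) (hb : 0 ≤ b) :
    (∀ q ∈ Set.Icc b l, q * P.real (Set.Ici q) ≤ b) ∨
    ∃ p ∈ Set.Icc b l, b < p * P.real (Set.Ici p) ∧
      ∀ q ∈ Set.Icc b l, q * P.real (Set.Ici q) ≤ p * P.real (Set.Ici p) + ε := by
  by_cases hall : ∀ q ∈ Set.Icc b l, q * P.real (Set.Ici q) ≤ b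
  · exact Or.inl hall
  push Not at hall
  obtain ⟨q₀, hq₀, hq₀b⟩ := hall
  right
  set R : Set ℝ := (fun q => q * P.real (Set.Ici q)) '' Set.Icc b l with hR
  have hbdd : BddAbove R := by
    refine ⟨l, ?_⟩
    rintro _ ⟨q, hq, rfl⟩
    exact (mul_le_of_le_one_right (hb.trans hq.1) measureReal_le_one).trans hq.2
  have hne : R.Nonempty := ⟨_, q₀, hq₀, rfl⟩
  have hlt : max b (sSup R - ε) < sSup R :=
    max_lt (hq₀b.trans_le (le_csSup hbdd ⟨q₀, hq₀, rfl⟩)) (by linarith)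
  obtain ⟨_, ⟨p, hp, rfl⟩, hpR⟩ := exists_lt_of_lt_csSup hne hlt
  refine ⟨p, hp, (le_max_left _ _).trans_lt hpR, fun q hq => ?_⟩
  have h1 := le_csSup hbdd ⟨q, hq, rfl⟩
  have h2 := (le_max_right _ _).trans_lt hpR
  linarith

/-! ### Numerical estimates of logarithms -/

theorem log_le_of_le_sum {x a : ℝ} (hx : 0 < x) (ha : 0 ≤ a) (n : ℕ)
    (h : x ≤ ∑ i ∈ Finset.range n, a ^ i / (i.factorial : ℝ)) : Real.log x ≤ a :=
  (Real.log_le_iff_le_exp hx).mpr (h.trans (Real.sum_le_exp_of_nonneg ha n))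

/-- The logarithm lies below its tangent at `exp n`, and so below any line of larger slope. -/
theorem log_le_tangent {y : ℝ} (hy : 0 < y) (n : ℕ) {e : ℝ} (he0 : 0 < e) (he : e ≤ Real.exp n) :
    Real.log y ≤ n - 1 + y / e := by
  have h := Real.add_one_le_exp (Real.log y - n)
  rw [Real.exp_sub, Real.exp_log hy] at h
  have : y / Real.exp n ≤ y / e := div_le_div_of_nonneg_left hy.le he0 he
  linarith

theorem log_three_halves_le : Real.log 1.5 ≤ 0.4056 :=
  log_le_of_le_sum (by norm_num) (by norm_num) 6 (by
    norm_num [Finset.sum_range_succ, Nat.factorial])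

theorem pow_le_exp (n : ℕ) : (2.7182 : ℝ) ^ n ≤ Real.exp n := by
  have := Real.exp_one_gt_d9
  rw [← Real.exp_one_pow]
  gcongr
  linarith

namespace CloseToProduct

variable {V δ : ℝ} {T : Set (Fin m → ℝ)} {D : Measure (Fin m → ℝ)} {ν : Fin m → Measure ℝ}

/-- Prices that are exceeded with positive probability for each item are exceeded simultaneously
under independence. -/
theorem sum_le_of_pos (h : CloseToProduct V T D ν δ) {p : Fin m → ℝ}
    (hp : ∀ i, 0 < (ν i).real (Set.Ici (p i))) : ∑ i, p i ≤ V := by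
  have := h.prob_item
  have hpos : (Measure.pi ν) (Set.univ.pi fun i => Set.Ici (p i)) ≠ 0 := by
    rw [Measure.pi_pi]
    refine Finset.prod_ne_zero_iff.mpr fun i _ h0 => ?_
    have := hp i
    rw [measureReal_def, h0] at this
    simp at this
  obtain ⟨t, ht, htT⟩ : ∃ t ∈ Set.univ.pi fun i => Set.Ici (p i), t ∈ T := by
    by_contra! hcon
    exact hpos (measure_mono_null (fun t ht => hcon t ht) (ae_iff.mp h.mem_pi))
  exact (Finset.sum_le_sum fun i _ => ht i (Set.mem_univ i)).trans (h.typeSpace.sum_le t htT)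

theorem item_mem (h : CloseToProduct V T D ν δ) (i : Fin m) : ∀ᵐ x ∂(ν i), x ∈ Set.Icc 0 V := by
  have := h.prob_item
  have hp : Measurable fun t : Fin m → ℝ => t i := measurable_pi_apply i
  have e : (Measure.pi ν).map (fun t => t i) = ν i := (measurePreserving_eval ν i).map_eq
  rw [← e]
  exact (ae_map_iff hp.aemeasurable measurableSet_Icc).mpr
    (h.mem_pi.mono fun t ht => type_mem_Icc h.typeSpace ht i)

theorem item_tail_le (h : CloseToProduct V T D ν δ) (i : Fin m) (q : ℝ) :
    (ν i).real (Set.Ici q) ≤ (Measure.pi ν).real {t | q ≤ ∑ j, t j} := by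
  have := h.prob_item
  have h1 := one_sub_prod_le_tail ν h.typeSpace h.mem_pi {i} (fun _ => q) (c := q)
    fun _ _ => le_rfl
  simpa using h1

/-- A price for an item, together with a bound on the revenue of all prices for the item, such
that replacing the price by one for the bundle under `D` leaves at most `b + ε`. -/
theorem exists_price (h : CloseToProduct V T D ν δ) {b ε : ℝ} (hb0 : 0 < b) (hε : 0 < ε)
    (hb : ∀ x, 0 < x → D.real {t | x ≤ ∑ i, t i} ≤ b / x) (i : Fin m) :
    ∃ p Val : ℝ, 0 ≤ p ∧ b ≤ Val ∧ (∀ q, b < q → q ≤ V → q * (ν i).real (Set.Ici q) ≤ Val) ∧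
      Val + p * (D.real {t | p ≤ ∑ j, t j} - (Measure.pi ν).real {t | p ≤ ∑ j, t j}) ≤ b + ε ∧
      (p = 0 ∨ (b ≤ p ∧ p ≤ V ∧ b < p * (ν i).real (Set.Ici p) ∧
        Val = p * (ν i).real (Set.Ici p) + ε)) := by
  have := h.prob_item
  rcases exists_nearly_optimal_price (ν i) (l := V) hε hb0.le with hno | ⟨p, hp, hpb, hpq⟩
  · exact ⟨0, b, le_rfl, le_rfl, fun q hq hqV => hno q ⟨hq.le, hqV⟩, by linarith, Or.inl rfl⟩
  · have hp0 := hb0.trans_le hp.1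
    refine ⟨p, p * (ν i).real (Set.Ici p) + ε, hp0.le, by linarith,
      fun q hq hqV => hpq q ⟨hq.le, hqV⟩, ?_, Or.inr ⟨hp.1, hp.2, hpb, rfl⟩⟩
    have h1 : p * D.real {t | p ≤ ∑ j, t j} ≤ b := by
      have := mul_le_mul_of_nonneg_left (hb p hp0) hp0.le
      rwa [mul_div_cancel₀ _ hp0.ne'] at this
    have h2 := mul_le_mul_of_nonneg_left (h.item_tail_le i p) hp0.le
    linarith

theorem integral_max_sub_le_zero (h : CloseToProduct V T D ν δ) :
    ∫ t, max (∑ i, t i - V) 0 ∂D ≤ 0 := by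
  have : ∫ t, max (∑ i, t i - V) 0 ∂D = 0 := integral_eq_zero_of_ae (h.mem.mono fun t ht =>
    max_eq_right (by linarith [(sum_type_mem h.typeSpace ht).2]))
  exact this.le

theorem integral_min_item_le (h : CloseToProduct V T D ν δ) {b : ℝ} (hb : 0 ≤ b) (i : Fin m) :
    ∫ x, min x b ∂(ν i) ≤ b := by
  have := h.prob_item
  exact integral_min_le hb ((h.item_mem i).mono fun x hx => hx.1)

/-- With one item there is no minor item, so that no price beats the optimal one. -/
theorem revenue_le_of_single {T : Set (Fin 1 → ℝ)} {D : Measure (Fin 1 → ℝ)}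
    {ν : Fin 1 → Measure ℝ} (h : CloseToProduct V T D ν δ) {M : Mechanism 1}
    (hIC : M.IncentiveCompatible T) (hIR : M.IndividuallyRational T) {b : ℝ} (hb0 : 0 < b)
    (hb : ∀ x, 0 < x → D.real {t | x ≤ ∑ i, t i} ≤ b / x) : M.revenue D ≤ b := by
  have hprob := h.prob
  set P : Measure ℝ := D.map fun t => t 0 with hP
  have hPp : IsProbabilityMeasure P :=
    Measure.isProbabilityMeasure_map (measurable_pi_apply 0).aemeasurable
  have hDpi : Measure.pi (fun _ : Fin 1 => P) = D := by
    refine Measure.pi_eq fun s hs => ?_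
    rw [Fin.prod_univ_one, hP, Measure.map_apply (measurable_pi_apply 0) (hs 0)]
    congr 1
    ext t
    simp [Set.mem_pi, Fin.forall_fin_one]
  have h0 : CloseToProduct V T D (fun _ => P) 0 :=
    { typeSpace := h.typeSpace
      prob := h.prob
      prob_item := fun _ => hPp
      mem := h.mem
      mem_pi := by rw [hDpi]; exact h.mem
      tv_le := by rw [hDpi]; simp [tvDist] }
  have key := h0.integral_pay_le hIC hIR one_pos (L := V) (b := b) (O := V) hb0.le
    (Val := fun _ => b) (p := fun _ => 0) (fun i => h0.integral_min_item_le hb0.le i)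
    (fun i q hbq hqV => ?_) (fun s hs => by simp [hs.1]) h.nonneg (fun _ => le_rfl)
  · have hE : ∀ t : Fin 1 → ℝ, ∀ i, minorExcess V b t i = 0 := fun t i => by
      rw [minorExcess, if_neg]
      intro hmin
      refine hmin.1 fun j => ?_
      rw [Subsingleton.elim j i]
      simp
    simp only [hE] at key
    have := h.integral_max_sub_le_zero
    simp at key this ⊢
    linarith
  · refine (integral_priceKernel_le hb0.le hbq q (max_le hbq.le ?_)).trans ?_
    · linarith [le_max_right (q - V) 0]
    · have h1 := (h0.item_tail_le i q).trans (h0.real_pi_sum_le hb (hb0.trans hbq))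
      have h2 := mul_le_mul_of_nonneg_left h1 (hb0.trans hbq).le
      rwa [add_zero, mul_div_cancel₀ _ (hb0.trans hbq).ne'] at h2

theorem integral_max_sum_sub_le (h : CloseToProduct V T D ν δ) {b : ℝ}
    (hb : ∀ x, 0 < x → D.real {t | x ≤ ∑ i, t i} ≤ b / x) {L : ℝ} (hL : 0 < L) (hLV : L ≤ V) :
    ∫ t, max (∑ i, t i - L) 0 ∂D ≤ b * Real.log (V / L) := by
  have := h.prob
  exact integral_max_sub_le_log measurable_sum_type hL hLV
    (h.mem.mono fun t ht => (sum_type_mem h.typeSpace ht).2)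
    fun x hx => hb x (hL.trans_le hx.1)

/-- The revenue is at most the value of all the items, whose tail is at most `b / x`. -/
theorem revenue_le_log (h : CloseToProduct V T D ν δ) {M : Mechanism m}
    (hIR : M.IndividuallyRational T) {b : ℝ} (hb0 : 0 < b)
    (hb : ∀ x, 0 < x → D.real {t | x ≤ ∑ i, t i} ≤ b / x) (hbV : b ≤ V) :
    M.revenue D ≤ b + b * Real.log (V / b) := by
  have := h.prob
  have hint : Integrable (fun t => max (∑ i, t i - b) 0) D :=
    integrable_of_ae_bounded (lo := 0) (hi := V)
      ((measurable_sum_type.sub_const b).max measurable_const) (h.mem.mono fun t ht =>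
        ⟨le_max_right _ _, max_le (by linarith [(sum_type_mem h.typeSpace ht).2]) h.nonneg⟩)
  refine le_trans ?_ (add_le_add_right (h.integral_max_sum_sub_le hb hb0 hbV) b)
  have e : b + ∫ t, max (∑ i, t i - b) 0 ∂D = ∫ t, (b + max (∑ i, t i - b) 0) ∂D := by
    rw [integral_add (integrable_const _) hint]; simp
  rw [e]
  by_cases hi : Integrable M.pay D
  · refine integral_mono_ae hi ((integrable_const _).add hint) (h.mem.mono fun t ht => ?_)
    have := M.pay_le_sum h.typeSpace hIR ht
    have := le_max_left (∑ i, t i - b) 0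
    simp only
    linarith
  · rw [Mechanism.revenue, integral_undef hi]
    exact integral_nonneg fun t => add_nonneg hb0.le (le_max_right _ _)

end CloseToProduct

/-! ### Two items -/

/-- The price kernel when a price `P` above `L` is known to sell often: values above `P` pay less. -/
theorem integral_priceKernel_le_two {S : Measure ℝ} [IsProbabilityMeasure S] {L b q P : ℝ}
    (hb : 0 ≤ b) (hbq : b < q) (hqP : q ≤ P) :
    ∫ x, priceKernel L b q x ∂S
      ≤ q * S.real (Set.Ici q) - (q - max b (q - (P - L))) * S.real (Set.Ici P) := by
  have h : ∀ c p : ℝ, ∫ x, (Set.Ici p).indicator (fun _ => c) x ∂S = c * S.real (Set.Ici p) := by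
    intro c p
    rw [integral_indicator_const _ measurableSet_Ici, smul_eq_mul, mul_comm]
  have hi : ∀ c p : ℝ, Integrable ((Set.Ici p).indicator fun _ => c) S := fun c p =>
    (integrable_const _).indicator measurableSet_Ici
  rw [← h, ← h, ← integral_sub (hi _ _) (hi _ _)]
  refine integral_mono_of_nonneg (Filter.Eventually.of_forall fun x => ?_)
    ((hi _ _).sub (hi _ _)) (Filter.Eventually.of_forall fun x => ?_)
  · simp only [priceKernel, if_neg (not_le.mpr hbq), Pi.zero_apply]
    split_ifs
    exacts [hb.trans (le_max_left _ _), le_rfl]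
  · simp only [priceKernel, if_neg (not_le.mpr hbq), Set.indicator_apply, Set.mem_Ici]
    split_ifs with hx hx' hx'
    · rw [sub_sub_cancel]
      refine max_le_max le_rfl ?_
      linarith [le_max_left (x - L) 0]
    · rw [sub_zero]
      exact max_le hbq.le (by linarith [le_max_right (x - L) 0])
    · exact absurd (hqP.trans hx') hx
    · simp

theorem univ_eq_pair : ∀ i j : Fin 2, i ≠ j → (Finset.univ : Finset (Fin 2)) = {i, j} := by
  decide

namespace CloseToProduct

variable {V : ℝ} {T : Set (Fin 2 → ℝ)} {D : Measure (Fin 2 → ℝ)} {ν : Fin 2 → Measure ℝ}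

/-- The bound of `integral_minorExcess_le` with the cut at `1.5 * b`; the logarithm is estimated by
its tangent at `exp 2`, which suffices for `V ≥ 20 * b`. -/
theorem integral_minorExcess_le_two {b : ℝ} (h : CloseToProduct V T D ν (b / V)) (hb0 : 0 < b)
    (hb : ∀ x, 0 < x → D.real {t | x ≤ ∑ i, t i} ≤ b / x) (hV : 20 * b ≤ V) (L : ℝ) :
    ∫ t, ∑ i, minorExcess L b t i ∂(Measure.pi ν) ≤ 0.565 * b := by
  have hV0 : 0 < V := by linarith
  have hδ : b / V ≤ 1 / 20 := by rw [div_le_iff₀ hV0]; linarith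
  have hδ0 : 0 < b / V := by positivity
  refine (h.integral_minorExcess_le two_pos hb0 hδ0.le hb L (x₁ := 1.5) (y := 0.7167)
    (κ := 0.43) (by norm_num) (by linarith) (by norm_num at hδ ⊢; linarith) (by norm_num)
    fun h' hh hw => sum_sub_le_sq_two hh hw).trans ?_
  have hC : ∑ k ∈ Finset.Icc (2 : ℕ) 2, 1 / (k : ℝ) = 1 / 2 := by simp
  rw [hC]
  have hlog := log_three_halves_le
  have hy : 0 < V / (2 * 1.5 * b) := by positivity
  have he2 := pow_le_exp 2
  have hlog2 := log_le_tangent hy 2 (e := 7.388) (by norm_num) (by norm_num at he2 ⊢; linarith)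
  have e1 : b * (1 / 2) * Real.log 1.5 ≤ 0.2028 * b := by nlinarith
  have e2 : b * (b / V) ≤ b * (1 / 20) := by gcongr
  have e3 : 2 * b * (b / V) * Real.log (V / (2 * 1.5 * b))
      ≤ 2 * b * (b / V) * (1 + V / (2 * 1.5 * b) / 7.388) := by
    gcongr
    norm_num at hlog2 ⊢
    linarith
  have e4 : 2 * b * (b / V) * (1 + V / (2 * 1.5 * b) / 7.388)
      = 2 * (b * (b / V)) + 2 / (3 * 7.388) * b := by
    field_simp; ring
  have e5 : b ^ 2 * (1 / (1.5 * b) - 2 / V) = b / 1.5 - 2 * (b * (b / V)) := by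
    field_simp
  have e6 : (b / V) ^ 2 * (V / 2 - 1.5 * b) ≤ b * (b / V) / 2 := by
    have : (b / V) ^ 2 * (V / 2 - 1.5 * b) = b * (b / V) / 2 - 1.5 * b * (b / V) ^ 2 := by
      field_simp
    have : 0 ≤ 1.5 * b * (b / V) ^ 2 := by positivity
    linarith
  rw [e5]
  norm_num at e1 e2 e3 e4 e6 ⊢
  linarith

/-- The cheaper of two prices that both beat `b` for their items is small: independence would make
the bundle sell too well at the cheaper price. -/
theorem sq_le_of_two_prices {b : ℝ} (h : CloseToProduct V T D ν (b / V)) (hb0 : 0 < b)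
    (hV0 : 0 < V) (hb : ∀ x, 0 < x → D.real {t | x ≤ ∑ i, t i} ≤ b / x) {i j : Fin 2} (hij : i ≠ j)
    {p P : ℝ} (hbp : b ≤ p) (hpP : p ≤ P) (hp : b < p * (ν i).real (Set.Ici p))
    (hP : b < P * (ν j).real (Set.Ici P)) : p ^ 2 ≤ b * V := by
  have := h.prob_item
  have hp0 : 0 < p := hb0.trans_le hbp
  have hP0 : 0 < P := hp0.trans_le hpP
  set x := (ν i).real (Set.Ici p) with hx
  set y := (ν j).real (Set.Ici P) with hy
  have hx0 : 0 < x := pos_of_mul_pos_right (hb0.trans hp) hp0.le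
  have hy0 : 0 < y := pos_of_mul_pos_right (hb0.trans hP) hP0.le
  have huniv : (Finset.univ : Finset (Fin 2)) = {i, j} := univ_eq_pair i j hij
  set r : Fin 2 → ℝ := fun k => if k = i then p else P with hr
  have hri : r i = p := by simp [hr]
  have hrj : r j = P := by simp [hr, hij.symm]
  have hsum : p + P ≤ V := by
    have h1 := h.sum_le_of_pos (p := r) (fun k => by
      have : k ∈ ({i, j} : Finset (Fin 2)) := huniv ▸ Finset.mem_univ k
      rcases Finset.mem_insert.mp this with rfl | hk
      · rwa [hri]
      · rw [Finset.mem_singleton.mp hk, hrj]; exact hy0)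
    rwa [huniv, Finset.sum_pair hij, hri, hrj] at h1
  have hG := (one_sub_prod_le_tail ν h.typeSpace h.mem_pi Finset.univ r (c := p) (fun k _ => by
    simp only [hr]; split_ifs; exacts [le_rfl, hpP])).trans (h.real_pi_sum_le hb hp0)
  rw [huniv, Finset.prod_pair hij, hri, hrj] at hG
  have hx1 : x ≤ 1 := measureReal_le_one
  have hy1 : y ≤ 1 := measureReal_le_one
  have hx' : b / p ≤ x := by rw [div_le_iff₀ hp0]; linarith
  have hy' : b / P ≤ y := by rw [div_le_iff₀ hP0]; linarith
  have hbp1 : b / p ≤ 1 := hx'.trans hx1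
  have h1 : (1 - x) * (1 - y) ≤ (1 - b / p) * (1 - b / P) :=
    mul_le_mul (by linarith) (by linarith) (by linarith) (by linarith)
  have h2 : b / P * (1 - b / p) ≤ b / V := by linarith
  have h3 : V * (p - b) ≤ P * p := by
    have e1 : b / P * (1 - b / p) = b * (p - b) / (P * p) := by field_simp
    rw [e1, div_le_div_iff₀ (mul_pos hP0 hp0) hV0] at h2
    have : b * (V * (p - b)) ≤ b * (P * p) := by linarith
    exact le_of_mul_le_mul_left this hb0
  nlinarith [mul_le_mul_of_nonneg_right (show P ≤ V - p by linarith) hp0.le]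

/-- Both items are posted at bundle prices in the transfer if the larger price is at most `0.68 V`.
Otherwise only the smaller one is, and the larger one is controlled by capping the item values at
`0.45 V`. -/
theorem revenue_le_of_two_of_le {b ε : ℝ} (h : CloseToProduct V T D ν (b / V)) (hb0 : 0 < b)
    (hb : ∀ x, 0 < x → D.real {t | x ≤ ∑ i, t i} ≤ b / x) (hV : 20 * b ≤ V) {M : Mechanism 2}
    (hIC : M.IncentiveCompatible T) (hIR : M.IndividuallyRational T) (hε : 0 < ε)
    {i j : Fin 2} (hij : i ≠ j) {p P Val ValP : ℝ} (hp0 : 0 ≤ p) (hpP : p ≤ P)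
    (hbVal : b ≤ Val) (hVal : ∀ q, b < q → q ≤ V → q * (ν i).real (Set.Ici q) ≤ Val)
    (hpVal : Val + p * (D.real {t | p ≤ ∑ k, t k} - (Measure.pi ν).real {t | p ≤ ∑ k, t k}) ≤ b + ε)
    (hp : p = 0 ∨ (b ≤ p ∧ p ≤ V ∧ b < p * (ν i).real (Set.Ici p) ∧
      Val = p * (ν i).real (Set.Ici p) + ε))
    (hbValP : b ≤ ValP) (hValP : ∀ q, b < q → q ≤ V → q * (ν j).real (Set.Ici q) ≤ ValP)
    (hPValP : ValP + P * (D.real {t | P ≤ ∑ k, t k} - (Measure.pi ν).real {t | P ≤ ∑ k, t k})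
      ≤ b + ε)
    (hP : P = 0 ∨ (b ≤ P ∧ P ≤ V ∧ b < P * (ν j).real (Set.Ici P) ∧
      ValP = P * (ν j).real (Set.Ici P) + ε)) :
    M.revenue D ≤ 3.94 * b + 2 * ε := by
  have := h.prob_item
  have hV0 : 0 < V := by linarith
  have hδ : b / V ≤ 1 / 20 := by rw [div_le_iff₀ hV0]; linarith
  have hδ0 : 0 < b / V := by positivity
  have hbV : b / V * V = b := by field_simp
  have huniv : (Finset.univ : Finset (Fin 2)) = {i, j} := univ_eq_pair i j hij
  have hmemij : ∀ k : Fin 2, k = i ∨ k = j := fun k => by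
    have : k ∈ ({i, j} : Finset (Fin 2)) := huniv ▸ Finset.mem_univ k
    simpa using this
  have hexc := h.integral_minorExcess_le_two hb0 hb hV
  have hpV : p ≤ 0.225 * V := by
    rcases hp with rfl | ⟨h1, -, h2, -⟩
    · positivity
    rcases hP with rfl | ⟨-, -, h3, -⟩
    · linarith
    have h4 := h.sq_le_of_two_prices hb0 hV0 hb hij h1 hpP h2 h3
    have h5 : p ^ 2 ≤ (0.225 * V) ^ 2 := by nlinarith
    exact le_of_sq_le_sq h5 (by positivity)
  set sel : ℝ → ℝ → Fin 2 → ℝ := fun x y k => if k = i then x else y with hsel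
  have hsi : ∀ x y, sel x y i = x := fun x y => by simp [hsel]
  have hsj : ∀ x y, sel x y j = y := fun x y => by simp [hsel, hij.symm]
  by_cases hPV : P ≤ 0.68 * V
  · have key := h.integral_pay_le hIC hIR two_pos (L := V) (b := b) (O := 1.36 * V) hb0.le
      (Val := sel Val ValP) (p := sel p P) (fun k => ?_) (fun k q hbq hqV => ?_)
      (fun s hs => ?_) hV0.le (fun k => ?_)
    · rw [huniv, Finset.sum_pair hij, ← huniv] at key
      simp only [hsi, hsj] at key
      have h1 := h.integral_max_sub_le_zero
      have h2 := hexc V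
      have h3 : b / V * (1.36 * V) = 1.36 * b := by field_simp
      linarith
    · refine (h.integral_min_item_le hb0.le k).trans ?_
      rcases hmemij k with rfl | rfl
      · rwa [hsi]
      · rwa [hsj]
    · refine (integral_priceKernel_le hb0.le hbq q (max_le hbq.le ?_)).trans ?_
      · linarith [le_max_right (q - V) 0]
      · rcases hmemij k with rfl | rfl
        · rw [hsi]; exact hVal q hbq hqV
        · rw [hsj]; exact hValP q hbq hqV
    · rw [huniv, Finset.sum_pair hij, hsi, hsj, min_eq_left hs.2]
      split_ifs <;> linarith [hs.2]
    · rcases hmemij k with rfl | rfl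
      · rwa [hsi]
      · rw [hsj]; exact hp0.trans hpP
  · push Not at hPV
    obtain ⟨-, hPV', hPb, rfl⟩ := hP.resolve_left (by
      rintro rfl
      linarith)
    have hP0 : 0 < P := by linarith
    set L := 0.45 * V with hL
    set x := (ν j).real (Set.Ici P) with hx
    have hr : P * x ≤ b + b / V * P := by
      have h1 := (h.item_tail_le j P).trans (h.real_pi_sum_le hb hP0)
      have h2 := mul_le_mul_of_nonneg_left h1 hP0.le
      rw [mul_add, mul_div_cancel₀ _ hP0.ne'] at h2
      linarith
    have hLx : L * x ≤ 1.112 * b := by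
      have h1 : L / P ≤ 0.45 / 0.68 := by
        rw [div_le_div_iff₀ hP0 (by norm_num), hL]; linarith
      have h2 : L * x = L / P * (P * x) := by field_simp
      rw [h2]
      calc L / P * (P * x) ≤ L / P * (b + b / V * P) := by gcongr
        _ = L / P * b + 0.45 * b := by rw [hL]; field_simp
        _ ≤ 0.45 / 0.68 * b + 0.45 * b := by gcongr
        _ ≤ 1.112 * b := by linarith
    have hbL : b ≤ L := by rw [hL]; linarith
    -- prices below `P` lose what the cap takes from the values above `P`; higher prices earn at
    -- most `L`
    have hker : ∀ q, b < q → q ≤ V → ∫ z, priceKernel L b q z ∂(ν j) ≤ 1.112 * b + ε := by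
      intro q hbq hqV
      have hq0 := hb0.trans hbq
      rcases le_or_gt q P with hqP | hqP
      · refine (integral_priceKernel_le_two hb0.le hbq hqP).trans ?_
        have hq := hValP q hbq hqV
        rcases le_total b (q - (P - L)) with hc | hc
        · rw [max_eq_right hc]
          have : (q - (q - (P - L))) * x = P * x - L * x := by ring
          rw [this]
          linarith
        · rw [max_eq_left hc]
          have h1 := (h.item_tail_le j q).trans (h.real_pi_sum_le hb hq0)
          have h2 := mul_le_mul_of_nonneg_left h1 hq0.le
          rw [mul_add, mul_div_cancel₀ _ hq0.ne'] at h2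
          have h3 : b / V ≤ x := by
            have : b / P ≤ x := by rw [div_le_iff₀ hP0]; linarith
            exact (div_le_div_of_nonneg_left hb0.le hP0 hPV').trans this
          have h4 : (q - b) * (b / V) ≤ (q - b) * x := by
            gcongr
          have h5 : b * (b / V) ≤ b * (1 / 20) := by gcongr
          linarith
      · refine (integral_priceKernel_le hb0.le hbq L (max_le hbL ?_)).trans ?_
        · linarith [le_max_left (q - L) 0]
        · have hq := hValP q hbq hqV
          have h1 : (ν j).real (Set.Ici q) ≤ x := measureReal_mono (Set.Ici_subset_Ici.mpr hqP.le)
          have hL0 : 0 ≤ L := hb0.le.trans hbL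
          have := mul_le_mul_of_nonneg_left h1 hL0
          linarith
    have key := h.integral_pay_le hIC hIR two_pos (L := L) (b := b) (O := L) hb0.le
      (Val := sel Val (1.112 * b + ε)) (p := sel p 0) (fun k => ?_) (fun k q hbq hqV => ?_)
      (fun s hs => ?_) (hb0.le.trans hbL) (fun k => ?_)
    · have h1 := h.integral_max_sum_sub_le hb (hb0.trans_le hbL) (by linarith : L ≤ V)
      have h2 := hexc L
      have h3 : b / V * L = 0.45 * b := by rw [hL]; field_simp
      have h4 : V / L = 1 / 0.45 := by rw [hL]; field_simp
      have h5 : Real.log (1 / 0.45) ≤ 0.8 :=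
        log_le_of_le_sum (by norm_num) (by norm_num) 8 (by
          norm_num [Finset.sum_range_succ, Nat.factorial])
      rw [h4] at h1
      have h6 := mul_le_mul_of_nonneg_left h5 hb0.le
      have h7 : ∑ k, (sel Val (1.112 * b + ε) k + sel p 0 k *
          (D.real {t | sel p 0 k ≤ ∑ l, t l} - (Measure.pi ν).real {t | sel p 0 k ≤ ∑ l, t l}))
          ≤ b + ε + (1.112 * b + ε) := by
        rw [huniv, Finset.sum_pair hij, ← huniv]
        simp only [hsi, hsj, zero_mul, add_zero]
        linarith
      linarith
    · refine (h.integral_min_item_le hb0.le k).trans ?_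
      rcases hmemij k with rfl | rfl
      · rwa [hsi]
      · rw [hsj]; linarith
    · rcases hmemij k with rfl | rfl
      · rw [hsi]
        refine (integral_priceKernel_le hb0.le hbq q (max_le hbq.le ?_)).trans (hVal q hbq hqV)
        linarith [le_max_right (q - L) 0]
      · rw [hsj]; exact hker q hbq hqV
    · rw [huniv, Finset.sum_pair hij, hsi, hsj]
      have h1 := min_le_left s L
      have h2 := min_le_right s L
      have h3 : p ≤ L / 2 := by rw [hL]; linarith
      split_ifs <;> linarith
    · rcases hmemij k with rfl | rfl
      · rwa [hsi]
      · rw [hsj]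

/-- The assumption `20 * b ≤ V` stands for `exp 3 * b ≤ V`. -/
theorem revenue_le_of_two {b : ℝ} (h : CloseToProduct V T D ν (b / V)) (hb0 : 0 < b)
    (hb : ∀ x, 0 < x → D.real {t | x ≤ ∑ i, t i} ≤ b / x) (hV : 20 * b ≤ V) {M : Mechanism 2}
    (hIC : M.IncentiveCompatible T) (hIR : M.IndividuallyRational T) :
    M.revenue D ≤ 3.98 * b := by
  have hε : 0 < b / 50 := by positivity
  obtain ⟨p, Val, a1, a2, a3, a4, a5⟩ := h.exists_price hb0 hε hb 0
  obtain ⟨P, ValP, c1, c2, c3, c4, c5⟩ := h.exists_price hb0 hε hb 1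
  rcases le_total p P with hpP | hpP
  · have := h.revenue_le_of_two_of_le hb0 hb hV hIC hIR hε (i := 0) (j := 1) (by decide)
      a1 hpP a2 a3 a4 a5 c2 c3 c4 c5
    linarith
  · have := h.revenue_le_of_two_of_le hb0 hb hV hIC hIR hε (i := 1) (j := 0) (by decide)
      c1 hpP c2 c3 c4 c5 a2 a3 a4 a5
    linarith

end CloseToProduct

/-! ### Three or more items -/

/-- If all prices in `[b, L]` earn at most `c` for an item, then so do all price kernels. -/
theorem integral_priceKernel_le_of_forall {P : Measure ℝ}
    [IsProbabilityMeasure P] {b L c q : ℝ} (hb : 0 ≤ b) (hbL : b ≤ L)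
    (hc : ∀ q ∈ Set.Icc b L, q * P.real (Set.Ici q) ≤ c) (hbq : b < q) :
    ∫ x, priceKernel L b q x ∂P ≤ c := by
  rcases le_total q L with hqL | hqL
  · refine (integral_priceKernel_le hb hbq q (max_le hbq.le ?_)).trans (hc q ⟨hbq.le, hqL⟩)
    linarith [le_max_right (q - L) 0]
  · refine (integral_priceKernel_le hb hbq L (max_le hbL ?_)).trans ?_
    · linarith [le_max_left (q - L) 0]
    · refine le_trans ?_ (hc L ⟨hbL, le_rfl⟩)
      exact mul_le_mul_of_nonneg_left (measureReal_mono (Set.Ici_subset_Ici.mpr hqL))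
        (hb.trans hbL)

namespace CloseToProduct

variable {V δ : ℝ} {T : Set (Fin m → ℝ)} {D : Measure (Fin m → ℝ)} {ν : Fin m → Measure ℝ}

/-- The induction behind `sum_price_le`. The
prices are added in decreasing order; the potential `b + δ * p i - p i * U`, where `p i` is the least
price and `U` the probability that some item sells, is nonnegative and pays for the next price. -/
theorem sum_price_le_aux (h : CloseToProduct V T D ν δ) {b L : ℝ} (hb0 : 0 < b) (hδ : 0 ≤ δ)
    (hb : ∀ x, 0 < x → D.real {t | x ≤ ∑ i, t i} ≤ b / x) (hL : δ * L ≤ b / 2) (p : Fin m → ℝ)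
    (J : Finset (Fin m)) (hp : ∀ i ∈ J, p i ∈ Set.Icc (2.25 * b) L) : J.Nonempty →
      ∃ i ∈ J, (∀ k ∈ J, p i ≤ p k) ∧
        ∑ k ∈ J, p k * (ν k).real (Set.Ici (p k)) + (b + δ * p i
          - p i * (1 - ∏ k ∈ J, (1 - (ν k).real (Set.Ici (p k))))) ≤ J.card * b + δ * L := by
  classical
  have := h.prob_item
  induction J using Finset.induction_on_min_value p with
  | empty => intro h; exact absurd h Finset.not_nonempty_empty
  | insert a s ha hmin ih =>
    intro _
    have hpa := hp a (Finset.mem_insert_self a s)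
    have hpa0 : 0 < p a := lt_of_lt_of_le (by linarith) hpa.1
    refine ⟨a, Finset.mem_insert_self a s, fun k hk => ?_, ?_⟩
    · rcases Finset.mem_insert.mp hk with rfl | hk
      exacts [le_rfl, hmin k hk]
    rw [Finset.sum_insert ha, Finset.prod_insert ha, Finset.card_insert_of_notMem ha]
    set x := (ν a).real (Set.Ici (p a)) with hx
    have hδL : δ * p a ≤ δ * L := mul_le_mul_of_nonneg_left hpa.2 hδ
    rcases s.eq_empty_or_nonempty with rfl | hs
    · simp
      linarith
    obtain ⟨c, hc, hcmin, hsum⟩ := ih (fun i hi => hp i (Finset.mem_insert_of_mem hi)) hs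
    have hpc := hp c (Finset.mem_insert_of_mem hc)
    have hpc0 : 0 < p c := lt_of_lt_of_le (by linarith) hpc.1
    have hac := hmin c hc
    have hU : p c * (1 - ∏ k ∈ s, (1 - (ν k).real (Set.Ici (p k)))) ≤ b + δ * p c := by
      have h1 := (one_sub_prod_le_tail ν h.typeSpace h.mem_pi s p hcmin).trans
        (h.real_pi_sum_le hb hpc0)
      have h2 := mul_le_mul_of_nonneg_left h1 hpc0.le
      rw [mul_add, mul_div_cancel₀ _ hpc0.ne'] at h2
      linarith
    have hX : p a * x ≤ b + δ * p a := by
      have h1 := (h.item_tail_le a (p a)).trans (h.real_pi_sum_le hb hpa0)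
      have h2 := mul_le_mul_of_nonneg_left h1 hpa0.le
      rw [mul_add, mul_div_cancel₀ _ hpa0.ne'] at h2
      linarith
    have hQ := prod_one_sub_mem s (h := fun k => (ν k).real (Set.Ici (p k)))
      fun k => ⟨measureReal_nonneg, measureReal_le_one⟩
    set Q := ∏ k ∈ s, (1 - (ν k).real (Set.Ici (p k))) with hQdef
    have hx0 : 0 ≤ x := measureReal_nonneg
    have hδL' : δ * p c ≤ δ * L := mul_le_mul_of_nonneg_left hpc.2 hδ
    -- both factors are at most `1.5 * b`, and `1.5 ^ 2 = 2.25`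
    have hprod : (p a * x) * (p c * (1 - Q)) ≤ b * p a := by
      calc (p a * x) * (p c * (1 - Q)) ≤ (1.5 * b) * (1.5 * b) :=
            mul_le_mul (by linarith) (by linarith)
              (mul_nonneg hpc0.le (by linarith [hQ.2])) (by positivity)
        _ = b * (2.25 * b) := by ring
        _ ≤ b * p a := by gcongr; exact hpa.1
    have hgap : (1 - Q) * (p c - p a) + p a * x * (1 - Q) ≤ b + δ * (p c - p a) := by
      refine le_of_mul_le_mul_left ?_ hpc0
      have h1 : p c * (1 - Q) * (p c - p a) ≤ (b + δ * p c) * (p c - p a) :=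
        mul_le_mul_of_nonneg_right hU (by linarith)
      nlinarith
    push_cast
    linarith

/-- Independent items that sell at prices in `[2.25 * b, L]` together earn at most `b` each, up to
`δ * L`. -/
theorem sum_price_le (h : CloseToProduct V T D ν δ) {b L : ℝ} (hb0 : 0 < b) (hδ : 0 ≤ δ)
    (hb : ∀ x, 0 < x → D.real {t | x ≤ ∑ i, t i} ≤ b / x) (hL0 : 0 ≤ L) (hL : δ * L ≤ b / 2)
    (p : Fin m → ℝ) (J : Finset (Fin m)) (hp : ∀ i ∈ J, p i ∈ Set.Icc (2.25 * b) L) :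
    ∑ k ∈ J, p k * (ν k).real (Set.Ici (p k)) ≤ J.card * b + δ * L := by
  have := h.prob_item
  rcases J.eq_empty_or_nonempty with rfl | hJ
  · simp; positivity
  obtain ⟨c, hc, hcmin, hsum⟩ := h.sum_price_le_aux hb0 hδ hb hL p J hp hJ
  have hpc0 : 0 < p c := lt_of_lt_of_le (by linarith) (hp c hc).1
  have h1 := (one_sub_prod_le_tail ν h.typeSpace h.mem_pi J p hcmin).trans
    (h.real_pi_sum_le hb hpc0)
  have h2 := mul_le_mul_of_nonneg_left h1 hpc0.le
  rw [mul_add, mul_div_cancel₀ _ hpc0.ne'] at h2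
  linarith

/-- No bundle prices are used in the transfer here. Items with optimal price below `2.25 * b` earn at
most `b + 2.25 * b * δ`, because they sell no better than the bundle; the others are treated by
`sum_price_le`. -/
theorem revenue_le_of_excess (h : CloseToProduct V T D ν δ) {b L : ℝ} (hm : 0 < m) (hb0 : 0 < b)
    (hδ : 0 < δ) (hb : ∀ x, 0 < x → D.real {t | x ≤ ∑ i, t i} ≤ b / x) (hbL : b ≤ L)
    (hLV : L ≤ V) (hL : δ * L ≤ b / 2) {M : Mechanism m}
    (hIC : M.IncentiveCompatible T) (hIR : M.IndividuallyRational T) :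
    M.revenue D ≤ b * Real.log (V / L) + m * b + b + 2.5 * m * (b * δ)
      + ∫ t, ∑ i, minorExcess L b t i ∂(Measure.pi ν) := by
  classical
  have := h.prob_item
  have hL0 : 0 < L := hb0.trans_le hbL
  have hε : 0 < b * δ / 4 := by positivity
  have hex : ∀ i, ∃ p Val : ℝ, b ≤ Val ∧
      (∀ q ∈ Set.Icc b L, q * (ν i).real (Set.Ici q) ≤ Val) ∧
      (Val ≤ b + 2.5 * (b * δ) ∨ (p ∈ Set.Icc (2.25 * b) L ∧
        Val = p * (ν i).real (Set.Ici p) + b * δ / 4)) := by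
    intro i
    rcases exists_nearly_optimal_price (ν i) (l := L) hε hb0.le with hno | ⟨p, hp, hpb, hpq⟩
    · exact ⟨0, b, le_rfl, hno, Or.inl (by nlinarith)⟩
    · refine ⟨p, _, by linarith, hpq, ?_⟩
      rcases le_or_gt (2.25 * b) p with h2 | h2
      · exact Or.inr ⟨⟨h2, hp.2⟩, rfl⟩
      · left
        have hp0 := hb0.trans_le hp.1
        have h1 := (h.item_tail_le i p).trans (h.real_pi_sum_le hb hp0)
        have h2 := mul_le_mul_of_nonneg_left h1 hp0.le
        rw [mul_add, mul_div_cancel₀ _ hp0.ne'] at h2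
        nlinarith
  choose p Val hVal1 hVal2 hVal3 using hex
  have key := h.integral_pay_le hIC hIR hm (L := L) (b := b) (O := L) hb0.le
    (Val := Val) (p := fun _ => 0) (fun i => (h.integral_min_item_le hb0.le i).trans (hVal1 i))
    (fun i q hbq _ => integral_priceKernel_le_of_forall hb0.le hbL (hVal2 i) hbq)
    (fun s hs => by simp) hL0.le (fun _ => le_rfl)
  have hs := h.integral_max_sum_sub_le hb hL0 hLV
  simp only [zero_mul, add_zero] at key
  set good : Fin m → Prop := fun i =>
    p i ∈ Set.Icc (2.25 * b) L ∧ Val i = p i * (ν i).real (Set.Ici (p i)) + b * δ / 4 with hgood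
  have hsplit := Finset.sum_filter_add_sum_filter_not Finset.univ good Val
  have hcard := Finset.card_filter_add_card_filter_not (s := (Finset.univ : Finset (Fin m))) good
  rw [Finset.card_univ, Fintype.card_fin] at hcard
  set J := Finset.univ.filter good with hJ
  set J' := Finset.univ.filter fun i => ¬ good i with hJ'
  have h1 : ∑ i ∈ J, Val i ≤ J.card * (b + 2.5 * (b * δ)) + b / 2 := by
    have e1 := h.sum_price_le hb0 hδ.le hb hL0.le hL p J fun i hi => (Finset.mem_filter.mp hi).2.1
    have e2 : ∑ i ∈ J, Val i
        = ∑ i ∈ J, p i * (ν i).real (Set.Ici (p i)) + J.card * (b * δ / 4) := by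
      rw [Finset.sum_congr rfl fun i hi => (Finset.mem_filter.mp hi).2.2, Finset.sum_add_distrib]
      simp
    have e3 : (J.card : ℝ) * (b * δ / 4) ≤ J.card * (2.5 * (b * δ)) := by
      gcongr; linarith
    linarith
  have h2 : ∑ i ∈ J', Val i ≤ J'.card * (b + 2.5 * (b * δ)) := by
    have : ∑ i ∈ J', Val i ≤ ∑ i ∈ J', (b + 2.5 * (b * δ)) := Finset.sum_le_sum fun i hi =>
      (hVal3 i).resolve_right (Finset.mem_filter.mp hi).2
    rwa [Finset.sum_const, nsmul_eq_mul] at this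
  have hcard' : (J.card : ℝ) + J'.card = m := by exact_mod_cast hcard
  have h3 : (J.card : ℝ) * (b + 2.5 * (b * δ)) + J'.card * (b + 2.5 * (b * δ))
      = m * b + 2.5 * m * (b * δ) := by rw [← add_mul, hcard']; ring
  linarith

/-- The assumption `148 * b ≤ V` stands for `exp 5 * b ≤ V`. -/
theorem revenue_le_of_three {T : Set (Fin 3 → ℝ)} {D : Measure (Fin 3 → ℝ)}
    {ν : Fin 3 → Measure ℝ} {b : ℝ} (h : CloseToProduct V T D ν (3 * b / (2 * V))) (hb0 : 0 < b)
    (hb : ∀ x, 0 < x → D.real {t | x ≤ ∑ i, t i} ≤ b / x) (hV : 148 * b ≤ V) {M : Mechanism 3}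
    (hIC : M.IncentiveCompatible T) (hIR : M.IndividuallyRational T) :
    M.revenue D ≤ 5.99 * b := by
  have hV0 : 0 < V := by linarith
  set δ := 3 * b / (2 * V) with hδdef
  have hδ : δ ≤ 0.01014 := by rw [hδdef, div_le_iff₀ (by positivity)]; linarith
  have hδ0 : 0 < δ := by positivity
  have hδV : δ * V = 1.5 * b := by rw [hδdef]; field_simp; norm_num
  have h1 := h.revenue_le_of_excess (L := V / 3) (by norm_num) hb0 hδ0 hb (by linarith)
    (by linarith) (by linarith) hIC hIR
  have h2 := h.integral_minorExcess_le (by norm_num) hb0 hδ0.le hb (V / 3) (x₁ := 1.5) (y := 0.677)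
    (κ := 0.59) (by norm_num) (by linarith) (by norm_num at hδ ⊢; linarith) (by norm_num)
    fun h' hh hw => sum_sub_le_sq_three hh hw
  have hC : ∑ k ∈ Finset.Icc (2 : ℕ) 3, 1 / (k : ℝ) = 5 / 6 := by
    rw [show Finset.Icc 2 3 = {2, 3} by decide, Finset.sum_pair (by norm_num)]; norm_num
  rw [hC] at h2
  have hlog := log_three_halves_le
  have hlog3 : Real.log 3 ≤ 1.1 := log_le_of_le_sum (by norm_num) (by norm_num) 7 (by
    norm_num [Finset.sum_range_succ, Nat.factorial])
  have hy : 0 < V / (2 * 1.5 * b) := by positivity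
  have he4 := pow_le_exp 4
  have hlog4 := log_le_tangent hy 4 (e := 54.5) (by norm_num) (by norm_num at he4 ⊢; linarith)
  have e0 : V / (V / 3) = 3 := by field_simp
  rw [e0] at h1
  have e1 : b * (5 / 6) * Real.log 1.5 ≤ 0.338 * b := by nlinarith
  have e1' : b * Real.log 3 ≤ 1.1 * b := by nlinarith
  have e2 : b * δ ≤ b * 0.01014 := by gcongr
  have e3 : 2 * b * δ * Real.log (V / (2 * 1.5 * b))
      ≤ 2 * b * δ * (3 + V / (2 * 1.5 * b) / 54.5) := by
    gcongr
    norm_num at hlog4 ⊢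
    linarith
  have e4 : 2 * b * δ * (3 + V / (2 * 1.5 * b) / 54.5) = 6 * (b * δ) + b / 54.5 := by
    have : 2 * b * δ * (3 + V / (2 * 1.5 * b) / 54.5)
        = 6 * (b * δ) + 2 * (δ * V) / (3 * 54.5) := by field_simp; ring
    rw [this, hδV]; ring
  have e5 : b ^ 2 * (1 / (1.5 * b) - 2 / V) ≤ b / 1.5 := by
    have : b ^ 2 * (1 / (1.5 * b) - 2 / V) = b / 1.5 - 2 * b ^ 2 / V := by field_simp
    have : 0 ≤ 2 * b ^ 2 / V := by positivity
    linarith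
  have e6 : δ ^ 2 * (V / 2 - 1.5 * b) ≤ 0.75 * (b * δ) := by
    have e : δ ^ 2 * (V / 2 - 1.5 * b) = δ * (δ * V) / 2 - 1.5 * b * δ ^ 2 := by ring
    have : 0 ≤ 1.5 * b * δ ^ 2 := by positivity
    rw [e, hδV]
    linarith
  norm_num at h1 h2 e1 e2 e3 e4 e5 e6 ⊢
  linarith

end CloseToProduct

theorem sum_one_div_le_log (hm : 1 ≤ m) :
    ∑ k ∈ Finset.Icc 2 m, 1 / (k : ℝ) ≤ Real.log m := by
  induction m, hm using Nat.le_induction with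
  | base => simp
  | succ n hn ih =>
    have hn0 : (0 : ℝ) < n := by exact_mod_cast hn
    rw [Finset.sum_Icc_succ_top (by omega)]
    have h := Real.log_le_sub_one_of_pos (show 0 < (n : ℝ) / (n + 1) by positivity)
    rw [Real.log_div hn0.ne' (by positivity)] at h
    have e : (n : ℝ) / (n + 1) - 1 = -(1 / (n + 1)) := by field_simp; ring
    push_cast
    linarith

theorem sq_le_exp (hm : 4 ≤ m) : 68.5 * (m : ℝ) ^ 2 ≤ Real.exp (2 * m - 1) := by
  have hm' : (4 : ℝ) ≤ m := by exact_mod_cast hm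
  have e : Real.exp (2 * m - 1) = Real.exp (7 : ℕ) * (Real.exp (m - 4)) ^ 2 := by
    rw [← Real.exp_nat_mul, ← Real.exp_add]
    congr 1
    push_cast
    ring
  have h1 : (1096 : ℝ) ≤ Real.exp (7 : ℕ) := by
    have := pow_le_exp 7
    norm_num at this ⊢
    linarith
  have h2 : (m : ℝ) / 4 ≤ Real.exp (m - 4) := by
    have := Real.add_one_le_exp ((m : ℝ) - 4)
    linarith
  rw [e]
  calc 68.5 * (m : ℝ) ^ 2 = 1096 * ((m : ℝ) / 4) ^ 2 := by ring
    _ ≤ Real.exp (7 : ℕ) * (Real.exp (m - 4)) ^ 2 := by gcongr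

namespace CloseToProduct

variable {V δ : ℝ} {T : Set (Fin m → ℝ)} {D : Measure (Fin m → ℝ)} {ν : Fin m → Measure ℝ}

/-- Here `V ≥ exp (2 m - 1) * b` is needed only through `V ≥ 68.5 * m ^ 2 * b`, which makes all
terms with `δ` small. -/
theorem revenue_le_of_four_le {b : ℝ} (h : CloseToProduct V T D ν (m * b / (2 * V)))
    (hm : 4 ≤ m) (hb0 : 0 < b) (hb : ∀ x, 0 < x → D.real {t | x ≤ ∑ i, t i} ≤ b / x)
    (hV : 68.5 * (m : ℝ) ^ 2 * b ≤ V) {M : Mechanism m}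
    (hIC : M.IncentiveCompatible T) (hIR : M.IndividuallyRational T) :
    M.revenue D ≤ (2 * m - 0.1) * b := by
  have hm' : (4 : ℝ) ≤ m := by exact_mod_cast hm
  have hm0 : (0 : ℝ) < m := by linarith
  have hV0 : 0 < V := lt_of_lt_of_le (by positivity) hV
  set δ := m * b / (2 * V) with hδdef
  have hδ0 : 0 < δ := by positivity
  have hδV : δ * V = m * b / 2 := by rw [hδdef]; field_simp
  have hmδ : m * δ ≤ 1 / 137 := by
    rw [hδdef, mul_div_assoc', div_le_div_iff₀ (by positivity) (by norm_num)]
    linarith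
  have hδ : δ ≤ 1 / 548 := by nlinarith
  have hmb : m * b ≤ V / 274 := by nlinarith
  have h1 := h.revenue_le_of_excess (L := V / m) (by omega) hb0 hδ0 hb
    (by rw [le_div_iff₀ hm0]; linarith) (div_le_self hV0.le (by linarith))
    (by rw [mul_div_assoc', hδV]; apply le_of_eq; field_simp) hIC hIR
  have h2 := h.integral_minorExcess_le (by omega) hb0 hδ0.le hb (V / m) (x₁ := 2) (y := 0.502)
    (κ := 0.8) (by norm_num) (by nlinarith) (by norm_num at hδ ⊢; linarith) (by norm_num)
    fun h' hh hw => sum_sub_le_sq hh hw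
  have e0 : V / (V / m) = m := by field_simp
  rw [e0] at h1
  have hC := sum_one_div_le_log (m := m) (by omega)
  have hlog2 := Real.log_two_lt_d9
  have hlogm : Real.log m ≤ 1.3863 + (m / 4 - 1) := by
    have h4 : Real.log 4 ≤ 1.3863 := by
      rw [show (4 : ℝ) = 2 ^ 2 by norm_num, Real.log_pow]
      push_cast
      linarith
    have h5 := Real.log_le_sub_one_of_pos (show 0 < (m : ℝ) / 4 by positivity)
    rw [Real.log_div hm0.ne' (by norm_num)] at h5
    linarith
  have hlogm0 : 0 ≤ Real.log m := Real.log_nonneg (by linarith)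
  have e1 : b * (∑ k ∈ Finset.Icc 2 m, 1 / (k : ℝ)) * Real.log 2
      ≤ b * Real.log m * 0.6932 := by
    have := Real.log_pos one_lt_two
    gcongr
    linarith
  have e2 : b * (m * δ) ≤ b * (1 / 137) := by gcongr
  have e3 : 2 * b * δ * Real.log (V / (2 * 2 * b)) ≤ 0.122 * b := by
    set w := Real.sqrt (V / (2 * 2 * b)) with hw
    have hpos : 0 < V / (2 * 2 * b) := by positivity
    have hw0 : 0 < w := Real.sqrt_pos.mpr hpos
    have hw2 : w ^ 2 = V / (2 * 2 * b) := Real.sq_sqrt hpos.le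
    have hVw : V = 4 * b * w ^ 2 := by rw [hw2]; field_simp; norm_num
    have hlog : Real.log (V / (2 * 2 * b)) ≤ 2 * w := by
      rw [← hw2, Real.log_pow]
      have := Real.log_le_sub_one_of_pos hw0
      push_cast
      linarith
    have hwm : 4.1 * m ≤ w := by
      refine le_of_sq_le_sq ?_ hw0.le
      have : 68.5 * (m : ℝ) ^ 2 * b ≤ 4 * w ^ 2 * b := by linarith
      have := le_of_mul_le_mul_right this hb0
      nlinarith
    calc 2 * b * δ * Real.log (V / (2 * 2 * b)) ≤ 2 * b * δ * (2 * w) := by gcongr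
      _ = b * (m / (2 * w)) := by rw [hδdef, hVw]; field_simp; norm_num
      _ ≤ b * 0.122 := by
          gcongr
          rw [div_le_iff₀ (by positivity)]
          linarith
      _ = _ := by ring
  have e5 : b ^ 2 * (1 / (2 * b) - 2 / V) ≤ b / 2 := by
    have : b ^ 2 * (1 / (2 * b) - 2 / V) = b / 2 - 2 * b ^ 2 / V := by field_simp
    have : 0 ≤ 2 * b ^ 2 / V := by positivity
    linarith
  have e6 : δ ^ 2 * (V / 2 - 2 * b) ≤ b * (m * δ) / 4 := by
    have e : δ ^ 2 * (V / 2 - 2 * b) = δ * (δ * V) / 2 - 2 * b * δ ^ 2 := by ring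
    have : 0 ≤ 2 * b * δ ^ 2 := by positivity
    rw [e, hδV]
    linarith
  have e7 : b * Real.log m ≤ b * (1.3863 + (m / 4 - 1)) := by gcongr
  have e8 : 0 ≤ b * δ := by positivity
  have e9 : 4 * b ≤ m * b := by gcongr
  norm_num at h1 h2 e1 e2 e3 e5 e6 e7 ⊢
  linarith

end CloseToProduct

/-! ### The comparison with the revenue of the grand bundle -/

section Revenue

variable {V : ℝ} {T : Set (Fin m → ℝ)} {D : Measure (Fin m → ℝ)}

theorem Rev_le {X : ℝ} (hX : 0 ≤ X) (h : ∀ M : Mechanism m, M.IncentiveCompatible T →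
    M.IndividuallyRational T → M.revenue D ≤ X) : Rev V T D ≤ X := by
  refine Real.sSup_le ?_ hX
  rintro r ⟨M, -, hIC, hIR, rfl⟩
  exact h M hIC hIR

/-- A posted price sells with probability at most the optimal posted-price revenue over the
price. -/
theorem real_le_iSup_div [IsProbabilityMeasure D] {f : (Fin m → ℝ) → ℝ}
    (hf : ∀ᵐ t ∂D, f t ≤ V) (hV : 0 ≤ V) {x : ℝ} (hx : 0 < x) :
    D.real {t | x ≤ f t} ≤ (⨆ p : NNReal, (p : ℝ) * D.real {t | (p : ℝ) ≤ f t}) / x := by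
  rw [le_div_iff₀ hx, mul_comm]
  refine le_ciSup (f := fun p : NNReal => (p : ℝ) * D.real {t | (p : ℝ) ≤ f t}) ⟨V, ?_⟩
    ⟨x, hx.le⟩
  rintro _ ⟨p, rfl⟩
  rcases le_or_gt (p : ℝ) V with hp | hp
  · exact (mul_le_of_le_one_right p.2 measureReal_le_one).trans hp
  · have : D.real {t | (p : ℝ) ≤ f t} = 0 := by
      rw [measureReal_def, measure_mono_null (t := {t | ¬ f t ≤ V}) (fun t ht => ?_) (ae_iff.mp hf)]
      · simp
      · simp only [Set.mem_ofPred_eq, not_le] at ht ⊢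
        linarith
    simpa [this] using hV

theorem closeToProduct_of_tvDist_le {ν : Fin m → Measure ℝ} {δ : ℝ} (hT : IsTypeSpace V T)
    (hD : IsDistributionOn T D) (hν : ∀ i, IsProbabilityMeasure (ν i))
    (hDp : IsDistributionOn T (Measure.pi ν)) (h : tvDist D (Measure.pi ν) ≤ δ) :
    CloseToProduct V T D ν δ :=
  ⟨hT, hD.isProbabilityMeasure, hν, ae_of_isDistributionOn hD, ae_of_isDistributionOn hDp, h⟩

theorem Rev_le_of_le_sum (hT : IsTypeSpace V T) (hD : IsDistributionOn T D) {X : ℝ} (hX : 0 ≤ X)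
    (h : ∀ t ∈ T, ∑ i, t i ≤ X) : Rev V T D ≤ X := by
  have := hD.isProbabilityMeasure
  refine Rev_le hX fun M hIC hIR => ?_
  by_cases hi : Integrable M.pay D
  · have := integral_mono_ae hi (integrable_const X) ((ae_of_isDistributionOn hD).mono
      fun t ht => (M.pay_le_sum hT hIR ht).trans (h t ht))
    rw [integral_const, probReal_univ, one_smul] at this
    exact this
  · rw [Mechanism.revenue, integral_undef hi]
    exact hX

/-- If `D` were closer to a product, then every mechanism would earn less than `2 * m * b`, with `b`
equal to `Rev V T D / (2 * m)`. -/
theorem Rev_div_le_tvDist_of_BRev (hT : IsTypeSpace V T) (hD : IsDistributionOn T D)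
    (hRev : 2 * (m : ℝ) * BRev D ≤ Rev V T D) {ν : Fin m → Measure ℝ}
    (hν : ∀ i, IsProbabilityMeasure (ν i)) (hDp : IsDistributionOn T (Measure.pi ν)) :
    Rev V T D / (4 * V) ≤ tvDist D (Measure.pi ν) := by
  have hprob := hD.isProbabilityMeasure
  by_contra! hlt
  have h := closeToProduct_of_tvDist_le hT hD hν hDp hlt.le
  have hpos := (tvDist_nonneg D (Measure.pi ν)).trans_lt hlt
  have hV0 : 0 < V := by
    refine h.nonneg.lt_of_ne fun e => ?_
    rw [← e] at hpos
    simp at hpos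
  set R := Rev V T D with hR
  have hR0 : 0 < R := by
    rcases lt_or_ge 0 R with h0 | h0
    · exact h0
    · exact absurd hpos (not_lt.mpr (div_nonpos_of_nonpos_of_nonneg h0 (by linarith)))
  rcases Nat.eq_zero_or_pos m with rfl | hm
  · have := Rev_le_of_le_sum hT hD le_rfl (fun t _ => by simp)
    linarith
  have hm0 : (0 : ℝ) < m := by exact_mod_cast hm
  have hm1 : (1 : ℝ) ≤ m := by exact_mod_cast hm
  set b := R / (2 * m) with hbdef
  have hb0 : 0 < b := by positivity
  have hRb : R = 2 * m * b := by rw [hbdef]; field_simp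
  have hb : ∀ x, 0 < x → D.real {t | x ≤ ∑ i, t i} ≤ b / x := by
    intro x hx
    refine (real_le_iSup_div (h.mem.mono fun t ht => hT.sum_le t ht) hV0.le hx).trans ?_
    gcongr
    rw [hbdef, le_div_iff₀ (by positivity)]
    simp only [BRev] at hRev
    linarith
  have hRV : R ≤ V := Rev_le_of_le_sum hT hD hV0.le hT.sum_le
  have hbV : b ≤ V := by nlinarith
  have hδ : R / (4 * V) = m * b / (2 * V) := by rw [hRb]; field_simp; norm_num
  rw [hδ] at h
  have hlogV : 0 ≤ Real.log (V / b) := Real.log_nonneg (by rwa [le_div_iff₀ hb0, one_mul])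
  -- the revenue is so much larger than `b` that the values must be spread over many scales
  have hexp : Real.exp (2 * m - 1) * b ≤ V := by
    have h1 : R ≤ b + b * Real.log (V / b) :=
      Rev_le (by positivity) fun M _ hIR => h.revenue_le_log hIR hb0 hb hbV
    have h2 : 2 * (m : ℝ) - 1 ≤ Real.log (V / b) := by
      refine le_of_mul_le_mul_left ?_ hb0
      linarith
    have h3 := (Real.le_log_iff_exp_le (by positivity)).mp h2
    rwa [le_div_iff₀ hb0] at h3
  -- for given `m`, the exponential is replaced by a rational number
  have hexp_nat : ∀ n : ℕ, 2 * (m : ℝ) - 1 = n → ∀ c : ℝ, c ≤ (2.7182 : ℝ) ^ n → c * b ≤ V := by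
    intro n hn c hc
    refine le_trans ?_ hexp
    rw [hn]
    gcongr
    exact hc.trans (pow_le_exp n)
  suffices hX : ∃ X, 0 ≤ X ∧ X < R ∧ ∀ M : Mechanism m, M.IncentiveCompatible T →
      M.IndividuallyRational T → M.revenue D ≤ X by
    obtain ⟨X, hX0, hXR, hX⟩ := hX
    exact absurd (Rev_le (V := V) hX0 hX) (not_le.mpr hXR)
  obtain rfl | rfl | rfl | hm4 : m = 1 ∨ m = 2 ∨ m = 3 ∨ 4 ≤ m := by omega
  · exact ⟨b, hb0.le, by rw [hRb]; norm_num; linarith, fun M hIC hIR =>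
      h.revenue_le_of_single hIC hIR hb0 hb⟩
  · have e : ((2 : ℕ) : ℝ) * b / (2 * V) = b / V := by push_cast; field_simp
    rw [e] at h
    exact ⟨3.98 * b, by positivity, by rw [hRb]; push_cast; linarith, fun M hIC hIR =>
      h.revenue_le_of_two hb0 hb (hexp_nat 3 (by norm_num) 20 (by norm_num)) hIC hIR⟩
  · exact ⟨5.99 * b, by positivity, by rw [hRb]; push_cast; linarith, fun M hIC hIR =>
      CloseToProduct.revenue_le_of_three (by exact_mod_cast h) hb0 hb
        (hexp_nat 5 (by norm_num) 148 (by norm_num)) hIC hIR⟩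
  · refine ⟨(2 * m - 0.1) * b, mul_nonneg (by linarith) hb0.le, by rw [hRb]; linarith,
      fun M hIC hIR => h.revenue_le_of_four_le hm4 hb0 hb ?_ hIC hIR⟩
    exact (mul_le_mul_of_nonneg_right (sq_le_exp hm4) hb0.le).trans hexp

end Revenue

/-! ### The comparison with the revenue of separate sales -/

namespace CloseToProduct

variable {V δ : ℝ} {T : Set (Fin m → ℝ)} {D : Measure (Fin m → ℝ)} {ν : Fin m → Measure ℝ}

theorem integral_max_sum_sub_le_of_items (h : CloseToProduct V T D ν δ) (hm : 1 ≤ m) {L : ℝ}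
    (hL : 0 < L) (hLV : L ≤ V) {ρ : Fin m → ℝ}
    (hρ : ∀ i x, 0 < x → D.real {t | x ≤ t i} ≤ ρ i / x) :
    ∫ t, max (∑ i, t i - L) 0 ∂D ≤ (∑ i, ρ i) * Real.log (V / (L / m)) := by
  have := h.prob
  have hm0 : (0 : ℝ) < m := by exact_mod_cast hm
  have hm1 : (1 : ℝ) ≤ m := by exact_mod_cast hm
  have hLm : 0 < L / m := by positivity
  have hint : ∀ i, Integrable (fun t : Fin m → ℝ => max (t i - L / m) 0) D := fun i =>
    integrable_of_ae_bounded (lo := 0) (hi := V) (by fun_prop) (h.mem.mono fun t ht =>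
      ⟨le_max_right _ _, max_le (by linarith [(type_mem_Icc h.typeSpace ht i).2]) h.nonneg⟩)
  calc ∫ t, max (∑ i, t i - L) 0 ∂D ≤ ∫ t, ∑ i, max (t i - L / m) 0 ∂D := by
        refine integral_mono_of_nonneg (Filter.Eventually.of_forall fun t => le_max_right _ _)
          (integrable_finsetSum _ fun i _ => hint i) (Filter.Eventually.of_forall fun t => ?_)
        refine max_le ?_ (Finset.sum_nonneg fun i _ => le_max_right _ _)
        have e : ∑ i, t i - L = ∑ i, (t i - L / m) := by
          rw [Finset.sum_sub_distrib]
          simp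
          field_simp
        rw [e]
        exact Finset.sum_le_sum fun i _ => le_max_left _ _
    _ = ∑ i, ∫ t, max (t i - L / m) 0 ∂D := integral_finsetSum _ fun i _ => hint i
    _ ≤ ∑ i, ρ i * Real.log (V / (L / m)) := Finset.sum_le_sum fun i _ =>
        integral_max_sub_le_log (measurable_pi_apply i) hLm
          ((div_le_self hL.le hm1).trans hLV)
          (h.mem.mono fun t ht => (type_mem_Icc h.typeSpace ht i).2)
          fun x hx => hρ i x (hLm.trans_le hx.1)
    _ = _ := by rw [Finset.sum_mul]

/-- Below `L`, the tails of the items under the product distribution are those of posted-price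
revenues `r i`, which include the error `δ * L` of the transfer. -/
theorem revenue_le_of_item_tails (h : CloseToProduct V T D ν δ) (hm : 2 ≤ m) (hδ : 0 < δ) {L : ℝ}
    (hL : 0 < L) {ρ : Fin m → ℝ} (hρ0 : ∀ i, 0 ≤ ρ i)
    (hρ : ∀ i x, 0 < x → D.real {t | x ≤ t i} ≤ ρ i / x) {M : Mechanism m}
    (hIC : M.IncentiveCompatible T) (hIR : M.IndividuallyRational T) :
    M.revenue D ≤ ∫ t, max (∑ i, t i - L) 0 ∂D
      + (∑ i, (ρ i + δ * L)) * (2.5 + Real.log m) + δ * L := by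
  have := h.prob_item
  have hm0 : (0 : ℝ) < m := by exact_mod_cast (by omega : 0 < m)
  have hm1 : (1 : ℝ) ≤ m := by exact_mod_cast (by omega : 1 ≤ m)
  set r : Fin m → ℝ := fun i => ρ i + δ * L with hr
  have hr0 : ∀ i, 0 < r i := fun i => add_pos_of_nonneg_of_pos (hρ0 i) (by positivity)
  have hsum0 : 0 < ∑ i, r i :=
    Finset.sum_pos (fun i _ => hr0 i) ⟨⟨0, by omega⟩, Finset.mem_univ _⟩
  have htail : ∀ i q, 0 < q → q ≤ L → (ν i).real (Set.Ici q) ≤ r i / q := by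
    intro i q hq hqL
    rw [← measureReal_pi_eval ν i measurableSet_Ici]
    refine (h.real_pi_le (measurable_pi_apply i measurableSet_Ici)).trans ?_
    have h1 : D.real ((fun t : Fin m → ℝ => t i) ⁻¹' Set.Ici q) ≤ ρ i / q := hρ i q hq
    have h2 : r i / q = ρ i / q + δ * (L / q) := by rw [hr]; field_simp
    have h3 : 1 ≤ L / q := by rwa [le_div_iff₀ hq, one_mul]
    nlinarith
  set b := min (∑ i, r i) L with hb
  have hb0 : 0 < b := lt_min hsum0 hL
  have hbL : b ≤ L := min_le_right _ _
  have hbr : b ≤ ∑ i, r i := min_le_left _ _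
  have hlogm : 0 ≤ Real.log m := Real.log_nonneg hm1
  have hmin : ∀ i, ∫ x, min x b ∂(ν i) ≤ b / m + r i * Real.log m := by
    intro i
    have hbm : 0 < b / m := by positivity
    have hbm' : b / m ≤ b := div_le_self hb0.le hm1
    have h1 : ∫ x, max (min x b - b / m) 0 ∂(ν i) ≤ r i * Real.log (b / (b / m)) := by
      refine integral_max_sub_le_log (by fun_prop) hbm hbm'
        (Filter.Eventually.of_forall fun x => min_le_right _ _) fun x hx => ?_
      refine le_trans (measureReal_mono fun z hz => ?_)
        (htail i x (hbm.trans_le hx.1) (hx.2.trans hbL))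
      exact (show x ≤ min z b from hz).trans (min_le_left _ _)
    have h2 : b / (b / m) = m := by field_simp
    rw [h2] at h1
    have hitem := h.item_mem i
    have hint : Integrable (fun x => max (min x b - b / m) 0) (ν i) :=
      integrable_of_ae_bounded (lo := 0) (hi := b) (by fun_prop)
        (Filter.Eventually.of_forall fun x => ⟨le_max_right _ _,
          max_le (by linarith [min_le_right x b]) hb0.le⟩)
    have h3 : ∫ x, min x b ∂(ν i) ≤ ∫ x, (b / m + max (min x b - b / m) 0) ∂(ν i) := by
      refine integral_mono_of_nonneg (hitem.mono fun x hx => le_min hx.1 hb0.le)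
        ((integrable_const _).add hint) (Filter.Eventually.of_forall fun x => ?_)
      simp only
      linarith [le_max_left (min x b - b / m) 0]
    rw [integral_add (integrable_const _) hint, integral_const, probReal_univ, one_smul] at h3
    linarith
  have hexc : ∫ t, ∑ i, minorExcess L b t i ∂(Measure.pi ν) ≤ (∑ i, r i) / 2 := by
    rw [integral_minorExcess_eq h.typeSpace h.mem_pi hb0 hbL fun t _ i hi => (hi.2 i).le]
    have hii : IntervalIntegrable (minorTail (Measure.pi ν) L) volume b L :=
      ((antitone_minorTail (Measure.pi ν) L).antitoneOn _).intervalIntegrable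
    have hint : IntervalIntegrable (fun x => 1 / 2 * ((∑ i, r i) / x + 0) ^ 2) volume b L := by
      refine ContinuousOn.intervalIntegrable fun x hx => ?_
      rw [Set.uIcc_of_le hbL] at hx
      have hx0 : x ≠ 0 := (hb0.trans_le hx.1).ne'
      exact ContinuousAt.continuousWithinAt (by fun_prop (disch := exact hx0))
    have h1 : ∫ x in b..L, minorTail (Measure.pi ν) L x
        ≤ ∫ x in b..L, 1 / 2 * ((∑ i, r i) / x + 0) ^ 2 := by
      refine intervalIntegral.integral_mono_on hbL hii hint fun x hx => ?_
      have hx0 := hb0.trans_le hx.1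
      refine (minorTail_pi_le ν L x).trans ((sum_sub_le_half_sq Finset.univ
        fun i => ⟨measureReal_nonneg, measureReal_le_one⟩).trans ?_)
      have h2 : ∑ i, (ν i).real (Set.Ici x) ≤ (∑ i, r i) / x + 0 := by
        rw [add_zero, Finset.sum_div]
        exact Finset.sum_le_sum fun i _ => htail i x hx0 hx.2
      have h3 : 0 ≤ ∑ i, (ν i).real (Set.Ici x) := Finset.sum_nonneg fun i _ => measureReal_nonneg
      have := pow_le_pow_left₀ h3 h2 2
      linarith
    rw [intervalIntegral.integral_const_mul, integral_sq_div_add hb0 hbL] at h1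
    have h4 : (∑ i, r i) ^ 2 * (1 / b - 1 / L) ≤ ∑ i, r i := by
      rcases le_total (∑ i, r i) L with hcase | hcase
      · have hbe : b = ∑ i, r i := min_eq_left hcase
        rw [hbe]
        have : (∑ i, r i) ^ 2 * (1 / (∑ i, r i) - 1 / L)
            = ∑ i, r i - (∑ i, r i) ^ 2 / L := by field_simp
        have : 0 ≤ (∑ i, r i) ^ 2 / L := by positivity
        linarith
      · have hbe : b = L := min_eq_right hcase
        rw [hbe, sub_self, mul_zero]
        exact hsum0.le
    simp only [mul_zero, zero_mul, add_zero, ne_eq, OfNat.ofNat_ne_zero, not_false_eq_true,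
      zero_pow] at h1 ⊢
    linarith
  have key := h.integral_pay_le hIC hIR (by omega) (L := L) (b := b) (O := L) hb0.le
    (Val := fun i => b / m + r i * Real.log m + r i) (p := fun _ => 0)
    (fun i => (hmin i).trans (by linarith [hr0 i]))
    (fun i q hbq _ => integral_priceKernel_le_of_forall hb0.le hbL (fun q hq => ?_) hbq)
    (fun s hs => by simp) hL.le (fun _ => le_rfl)
  · have hVal : ∑ i, (b / m + r i * Real.log m + r i)
        = b + (∑ i, r i) * Real.log m + ∑ i, r i := by
      rw [Finset.sum_add_distrib, Finset.sum_add_distrib, ← Finset.sum_mul]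
      simp
      field_simp
    simp only [zero_mul, add_zero] at key
    rw [hVal] at key
    linarith
  · have hq0 := hb0.trans_le hq.1
    have h1 := mul_le_mul_of_nonneg_left (htail i q hq0 hq.2) hq0.le
    rw [mul_div_cancel₀ _ hq0.ne'] at h1
    have h2 := mul_nonneg (hr0 i).le hlogm
    have h3 : 0 ≤ b / m := by positivity
    linarith

end CloseToProduct

/-- The cap `L = V / m ^ 6` makes the error of the transfer negligible, at the price of only a
constant factor in the logarithm. -/
theorem Rev_div_le_tvDist_of_SRev {V : ℝ} {T : Set (Fin m → ℝ)} {D : Measure (Fin m → ℝ)}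
    (hm : 2 ≤ m) (hT : IsTypeSpace V T) (hD : IsDistributionOn T D)
    (hRev : 16 * Real.log m * SRev D ≤ Rev V T D) {ν : Fin m → Measure ℝ}
    (hν : ∀ i, IsProbabilityMeasure (ν i)) (hDp : IsDistributionOn T (Measure.pi ν)) :
    Rev V T D / (4 * V) ≤ tvDist D (Measure.pi ν) := by
  have hprob := hD.isProbabilityMeasure
  by_contra! hlt
  have h := closeToProduct_of_tvDist_le hT hD hν hDp hlt.le
  have hpos := (tvDist_nonneg D (Measure.pi ν)).trans_lt hlt
  have hV0 : 0 < V := by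
    refine h.nonneg.lt_of_ne fun e => ?_
    rw [← e] at hpos
    simp at hpos
  set R := Rev V T D with hR
  have hR0 : 0 < R := by
    rcases lt_or_ge 0 R with h0 | h0
    · exact h0
    · exact absurd hpos (not_lt.mpr (div_nonpos_of_nonpos_of_nonneg h0 (by linarith)))
  have hm2 : (2 : ℝ) ≤ m := by exact_mod_cast hm
  have hm0 : (0 : ℝ) < m := by linarith
  set δ := R / (4 * V) with hδdef
  set ρ : Fin m → ℝ := fun i => ⨆ p : NNReal, (p : ℝ) * D.real {t | (p : ℝ) ≤ t i} with hρdef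
  have hρ0 : ∀ i, 0 ≤ ρ i := fun i =>
    Real.iSup_nonneg fun p => mul_nonneg p.2 measureReal_nonneg
  have hρ : ∀ i x, 0 < x → D.real {t | x ≤ t i} ≤ ρ i / x := fun i x hx =>
    real_le_iSup_div (h.mem.mono fun t ht => (type_mem_Icc hT ht i).2) hV0.le hx
  set σ := ∑ i, ρ i with hσ
  have hσ0 : 0 ≤ σ := Finset.sum_nonneg fun i _ => hρ0 i
  have hRev' : 16 * Real.log m * σ ≤ R := hRev
  set L := V / (m : ℝ) ^ 6 with hL
  have hL0 : 0 < L := by positivity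
  have hLV : L ≤ V := div_le_self hV0.le (one_le_pow₀ (by linarith))
  have hδL : δ * L = R / (4 * (m : ℝ) ^ 6) := by rw [hδdef, hL]; field_simp
  have hlog : Real.log (V / (L / m)) = 7 * Real.log m := by
    have : V / (L / m) = (m : ℝ) ^ 7 := by rw [hL]; field_simp
    rw [this, Real.log_pow]
    norm_num
  have hsum : ∑ i, (ρ i + δ * L) = σ + R / (4 * (m : ℝ) ^ 5) := by
    rw [Finset.sum_add_distrib, hδL]
    simp only [Finset.sum_const, Finset.card_univ, Fintype.card_fin, nsmul_eq_mul, ← hσ]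
    field_simp
  have hlogm : 0.69 ≤ Real.log m := by
    have h1 := Real.log_two_gt_d9
    have h2 := Real.log_le_log (by norm_num) hm2
    linarith
  have hlogm' : Real.log m ≤ m - 1 := Real.log_le_sub_one_of_pos hm0
  have hpow4 : (16 : ℝ) ≤ (m : ℝ) ^ 4 := by
    have := pow_le_pow_left₀ (by norm_num) hm2 4
    norm_num at this
    linarith
  have hpow6 : (64 : ℝ) ≤ (m : ℝ) ^ 6 := by
    have := pow_le_pow_left₀ (by norm_num) hm2 6
    norm_num at this
    linarith
  have e1 : R / (4 * (m : ℝ) ^ 6) ≤ R / 256 := by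
    apply div_le_div_of_nonneg_left hR0.le (by norm_num) (by linarith)
  have e2 : R / (4 * (m : ℝ) ^ 5) * (2.5 + Real.log m) ≤ R / 16 := by
    have h1 : (2.5 + Real.log m) ≤ 4 * m := by linarith
    calc R / (4 * (m : ℝ) ^ 5) * (2.5 + Real.log m) ≤ R / (4 * (m : ℝ) ^ 5) * (4 * m) := by
          gcongr
      _ = R / (m : ℝ) ^ 4 := by field_simp
      _ ≤ R / 16 := div_le_div_of_nonneg_left hR0.le (by norm_num) hpow4
  have e3 : σ * 0.69 ≤ σ * Real.log m := by gcongr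
  have hX0 : 0 ≤ 0.9 * R := by positivity
  refine absurd (Rev_le (V := V) (T := T) (D := D) hX0 fun M hIC hIR => ?_)
    (not_le.mpr (by linarith : 0.9 * R < R))
  have h1 := h.revenue_le_of_item_tails hm hpos hL0 hρ0 hρ hIC hIR
  have h2 := h.integral_max_sum_sub_le_of_items (by omega) hL0 hLV hρ
  rw [hlog] at h2
  rw [hsum, hδL, add_mul] at h1
  norm_num at h1 e2 e3 ⊢
  linarith

end SimpleVsOptimal

theorem mainTheorem7 :
    (∀ (m : ℕ) (V : ℝ) (T : Set (Fin m → ℝ)) (D : Measure (Fin m → ℝ)),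
      SimpleVsOptimal.IsTypeSpace V T → SimpleVsOptimal.IsDistributionOn T D →
      2 * (m : ℝ) * SimpleVsOptimal.BRev D ≤ SimpleVsOptimal.Rev V T D →
      ∀ Dp : Measure (Fin m → ℝ), SimpleVsOptimal.IsDistributionOn T Dp →
        SimpleVsOptimal.IsProductDistribution Dp →
        SimpleVsOptimal.Rev V T D / (4 * V) ≤ SimpleVsOptimal.tvDist D Dp) ∧
    (∃ C : ℝ, 0 < C ∧
      ∀ (m : ℕ), 2 ≤ m → ∀ (V : ℝ) (T : Set (Fin m → ℝ)) (D : Measure (Fin m → ℝ)),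
      SimpleVsOptimal.IsTypeSpace V T → SimpleVsOptimal.IsDistributionOn T D →
      C * Real.log m * SimpleVsOptimal.SRev D ≤ SimpleVsOptimal.Rev V T D →
      ∀ Dp : Measure (Fin m → ℝ), SimpleVsOptimal.IsDistributionOn T Dp →
        SimpleVsOptimal.IsProductDistribution Dp →
        SimpleVsOptimal.Rev V T D / (4 * V) ≤ SimpleVsOptimal.tvDist D Dp) := by
  refine ⟨?_, 16, by norm_num, ?_⟩
  · rintro m V T D hT hD hRev _ hDp ⟨ν, hν, rfl⟩
    exact SimpleVsOptimal.Rev_div_le_tvDist_of_BRev hT hD hRev hν hDp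
  · rintro m hm V T D hT hD hRev _ hDp ⟨ν, hν, rfl⟩
    exact SimpleVsOptimal.Rev_div_le_tvDist_of_SRev hm hT hD hRev hν hDp
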